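/- Let $p,q\ge 0$, $\beta_0\in\mathbb R^p$, $\gamma_0\in\mathbb R^{q+1}$, and let $n_j\ge 2$ for $j\ge 1$. Consider the heteroscedastic linear errors-in-variables model $$y_j=X_j^\top\beta_0+Z_j^\top\gamma_0+\varepsilon_j,\qquad W_{jk}=X_j+U_{jk},\qquad Z_j=(1,\tilde Z_j^\top)^\top,\qquad k=1,\dots,n_j,\ j\ge1,$$ with $X_j\in\mathbb R^p$, $\tilde Z_j\in\mathbb R^q$, where $E\,U_{jk}=0$, $\mathrm{Var}(U_{jk})=\Sigma_j$ may depend on $j$, and $E\,\varepsilon_j=0$. Assume: (C1) the observations $(X_j,\tilde Z_j,\varepsilon_j,U_{j1},\dots,U_{jn_j})$, $j\ge1$, are independent; for each $j$ the vectors $U_{j1},\dots,U_{jn_j}$ are independent, $(U_{j1},\dots,U_{jn_j})$ is independent of $(X_j,\tilde Z_j,\varepsilon_j)$, and $(X_j,\tilde Z_j)$ is independent of $\varepsilon_j$; the triples $(X_j,\tilde Z_j,\varepsilon_j)$ are identically distributed copies of $(X,\tilde Z,\varepsilon)$; (C3) every $U_{jk}$ and every $\varepsilon_j$ has a distribution symmetric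 about zero with real, strictly positive characteristic function; (C5) $\theta_0=(\beta_0,\gamma_0)$ is an interior point of a compact convex set $\Theta\subset\mathbb R^{p+q+1}$; (moments) $X_j,\tilde Z_j,\varepsilon_j,U_{jk}$ have finite second moments, and the diagonal entries of the $\Sigma_j$ are bounded uniformly in $j$; (identifiability) with $Z=(1,\tilde Z^\top)^\top$, the matrix $E[(X^\top,Z^\top)^\top(X^\top,Z^\top)]$ is positive definite; (weights) for each $n\ge1$, the numbers $q_1,\dots,q_n\ge0$ (which may depend on $n$) are non-random with $\sum_{j}q_j=1$ and $\max_j q_j=O(1/n)$. Fix $t^*>0$ and an integrable kernel $K\ge0$ on $\mathbb R$ that vanishes outside $[0,t^*]$. Put $W_j=n_j^{-1}\sum_kW_{jk}$, $$\hat\Sigma_j=\frac1{n_j(n_j-1)}\sum_{k<k'}(W_{jk}-W_{jk'})(W_{jk}-W_{jk'})^\top,$$ and, for $\theta=(\beta,\gamma)$, $e_j(\theta)=y_j-W_j^\top\beta-Z_j^\top\gamma$, $$\hat S_{L}(\theta)=\Big(-\frac2n\sum_{j=1}^n W_je_j(\theta)-\frac2n\sum_{j=1}^n\frac1{n_j}\hat\Sigma_j\beta,\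 \ -\frac2n\sum_{j=1}^n Z_je_j(\theta)\Big),$$ $$\tilde D(\theta)=\int_0^{t^*}\Big[C_y(t)\sum_{j=1}^n q_j\sin\{t(W_j^\top\beta+Z_j^\top\gamma)\}-S_y(t)\sum_{j=1}^n q_j\cos\{t(W_j^\top\beta+Z_j^\top\gamma)\}\Big]^2K(t)\,dt,$$ where $C_y(t)=n^{-1}\sum_j\cos(ty_j)$ and $S_y(t)=n^{-1}\sum_j\sin(ty_j)$. Let $S(\theta)=(\hat S_L(\theta),\nabla\tilde D(\theta))\in\mathbb R^{2(p+q+1)}$ be the stacked score, let $\Omega_S=\mathrm{Var}\,S(\theta_0)$ (it depends on $n$), and let $Q(\theta)=S(\theta)^\top\Omega_S^{-1}S(\theta)$. Assume finally that $\Omega_S$ is nonsingular for all large $n$ with $\|\Omega_S^{-1}\|=o(n^3)$. Then $S(\theta_0)$ has finite variance for every $n$, $Q$ has a minimizer over $\Theta$, and every estimator $\hat\theta_n=(\hat\beta,\hat\gamma)$ that minimizes $Q$ over $\Theta$ is consistent: $\hat\theta_n\to\theta_0$ in probability. No asymmetry of the covariates is assumed. -/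

import Mathlib

open MeasureTheory ProbabilityTheory Filter Topology
open scoped Matrix

noncomputable section

namespace EIV

/-- Index set of the parameter `θ = (β, γ)`, with `β ∈ ℝ^p` and `γ = (γ₀, …, γ_q) ∈ ℝ^(q+1)`. -/
abbrev Idx (p q : ℕ) : Type := Fin p ⊕ Fin (q + 1)

/-- The parameter vectors `θ = (β, γ) ∈ ℝ^(p+q+1)`. -/
abbrev Param (p q : ℕ) : Type := Idx p q → ℝ

/-- The `β`-part of a parameter. -/
def betaOf {p q : ℕ} (θ : Param p q) : Fin p → ℝ := fun a => θ (Sum.inl a)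

/-- The `γ`-part of a parameter. -/
def gammaOf {p q : ℕ} (θ : Param p q) : Fin (q + 1) → ℝ := fun b => θ (Sum.inr b)

/-- The error-free covariates with an intercept in front: `(1, z)`. -/
def withIntercept {q : ℕ} (z : Fin q → ℝ) : Fin (q + 1) → ℝ := Fin.cons 1 z

/-- Observed data. Observation `j` consists of `r j` replicates `W j k` of the contaminated
covariates, the error-free covariates `Z j` (without intercept) and the outcome `y j`.
A sample of size `n` consists of the observations `j = 0, …, n - 1`. -/
structure Data (p q : ℕ) where
  r : ℕ → ℕ
  W : (j : ℕ) → Fin (r j) → Fin p → ℝ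
  Z : ℕ → Fin q → ℝ
  y : ℕ → ℝ

section Sample

variable {p q : ℕ} (D : Data p q)

/-- Averaged replicates `W_j`. -/
def Data.Wbar (j : ℕ) : Fin p → ℝ := (D.r j : ℝ)⁻¹ • ∑ k, D.W j k

/-- `Z_j = (1, Z̃_j)`. -/
def Data.Z1 (j : ℕ) : Fin (q + 1) → ℝ := withIntercept (D.Z j)

/-- `W_jᵀ β + Z_jᵀ γ`. -/
def Data.lin (θ : Param p q) (j : ℕ) : ℝ :=
  D.Wbar j ⬝ᵥ betaOf θ + D.Z1 j ⬝ᵥ gammaOf θ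

/-- The replicate-based estimator of the error covariance matrix of observation `j`,
`1 / (n_j (n_j - 1)) * ∑_{k < k'} (W_jk - W_jk') (W_jk - W_jk')ᵀ`. -/
def Data.SigmaHat (j : ℕ) : Matrix (Fin p) (Fin p) ℝ :=
  ((D.r j : ℝ) * ((D.r j : ℝ) - 1))⁻¹ •
    ∑ k : Fin (D.r j), ∑ k' ∈ Finset.Ioi k,
      Matrix.vecMulVec (D.W j k - D.W j k') (D.W j k - D.W j k')

/-- The moment-corrected score in `β`, with the estimated error covariances plugged in. -/
def Data.scoreLbeta (n : ℕ) (θ : Param p q) : Fin p → ℝ :=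
  -((2 / (n : ℝ)) • ∑ j ∈ Finset.range n, (D.y j - D.lin θ j) • D.Wbar j)
    - (2 / (n : ℝ)) • ∑ j ∈ Finset.range n, (D.r j : ℝ)⁻¹ • (D.SigmaHat j *ᵥ betaOf θ)

/-- The moment-corrected score in `γ`. -/
def Data.scoreLgamma (n : ℕ) (θ : Param p q) : Fin (q + 1) → ℝ :=
  -((2 / (n : ℝ)) • ∑ j ∈ Finset.range n, (D.y j - D.lin θ j) • D.Z1 j)

/-- The moment-corrected score. -/
def Data.scoreL (n : ℕ) (θ : Param p q) : Idx p q → ℝ :=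
  Sum.elim (D.scoreLbeta n θ) (D.scoreLgamma n θ)

/-- `C_y(t) = n⁻¹ ∑_j cos (t y_j)`. -/
def Data.Cy (n : ℕ) (t : ℝ) : ℝ := (n : ℝ)⁻¹ * ∑ j ∈ Finset.range n, Real.cos (t * D.y j)

/-- `S_y(t) = n⁻¹ ∑_j sin (t y_j)`. -/
def Data.Sy (n : ℕ) (t : ℝ) : ℝ := (n : ℝ)⁻¹ * ∑ j ∈ Finset.range n, Real.sin (t * D.y j)

/-- The phase function discrepancy, with weights `w j`, kernel `K` and cutoff `tstar`. -/
def Data.phaseDisc (w : ℕ → ℝ) (K : ℝ → ℝ) (tstar : ℝ) (n : ℕ) (θ : Param p q) : ℝ :=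
  ∫ t in (0 : ℝ)..tstar,
    (D.Cy n t * (∑ j ∈ Finset.range n, w j * Real.sin (t * D.lin θ j))
      - D.Sy n t * (∑ j ∈ Finset.range n, w j * Real.cos (t * D.lin θ j))) ^ 2 * K t

/-- The phase function score: the vector of partial derivatives of the discrepancy. -/
def Data.scoreD (w : ℕ → ℝ) (K : ℝ → ℝ) (tstar : ℝ) (n : ℕ) (θ : Param p q) : Idx p q → ℝ :=
  fun i => deriv (fun s => D.phaseDisc w K tstar n (Function.update θ i s)) (θ i)

/-- The stacked score `S`, with `2 (p + q + 1)` components. -/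
def Data.score (w : ℕ → ℝ) (K : ℝ → ℝ) (tstar : ℝ) (n : ℕ) (θ : Param p q) :
    Idx p q ⊕ Idx p q → ℝ :=
  Sum.elim (D.scoreL n θ) (D.scoreD w K tstar n θ)

end Sample

section Model

variable {Ω : Type*} {p q : ℕ}

/-- The data generated by the linear errors-in-variables model with true parameter `θ₀`:
`y_j = X_jᵀ β₀ + (1, Z̃_j)ᵀ γ₀ + ε_j` and `W_jk = X_j + U_jk`, at the sample point `ω`. -/
def modelData (θ₀ : Param p q) (r : ℕ → ℕ) (X : ℕ → Ω → Fin p → ℝ) (Z : ℕ → Ω → Fin q → ℝ)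
    (ε : ℕ → Ω → ℝ) (U : (j : ℕ) → Fin (r j) → Ω → Fin p → ℝ) (ω : Ω) : Data p q where
  r := r
  W := fun j k => X j ω + U j k ω
  Z := fun j => Z j ω
  y := fun j => X j ω ⬝ᵥ betaOf θ₀ + withIntercept (Z j ω) ⬝ᵥ gammaOf θ₀ + ε j ω

variable [MeasurableSpace Ω]

/-- The matrix `Ω_S = Var(S)` for a random vector `S`. -/
def covMatrix {ι : Type*} (μ : Measure Ω) (S : Ω → ι → ℝ) : Matrix ι ι ℝ :=
  Matrix.of fun a b => cov[fun ω => S ω a, fun ω => S ω b; μ]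

/-- The quadratic form `Sᵀ M⁻¹ S`. -/
def quadForm {ι : Type*} [Fintype ι] [DecidableEq ι] (M : Matrix ι ι ℝ) (S : ι → ℝ) : ℝ :=
  S ⬝ᵥ (M⁻¹ *ᵥ S)

/-- The second moment matrix `E[(Xᵀ, 1, Z̃ᵀ)ᵀ (Xᵀ, 1, Z̃ᵀ)]` of the true covariates. -/
def covariateMoment (μ : Measure Ω) (X : Ω → Fin p → ℝ) (Z : Ω → Fin q → ℝ) :
    Matrix (Idx p q) (Idx p q) ℝ :=
  Matrix.of fun a b => ∫ ω, Sum.elim (X ω) (withIntercept (Z ω)) a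
    * Sum.elim (X ω) (withIntercept (Z ω)) b ∂μ

/-- The characteristic function `t ↦ E[exp(i tᵀ V)]` of a random vector. -/
def charFn {d : ℕ} (μ : Measure Ω) (V : Ω → Fin d → ℝ) (t : Fin d → ℝ) : ℂ :=
  ∫ ω, Complex.exp (Complex.I * ((t ⬝ᵥ V ω : ℝ) : ℂ)) ∂μ

/-- The law of `V` is symmetric about zero and its characteristic function is real and
strictly positive everywhere. -/
def SymmetricPositive {d : ℕ} (μ : Measure Ω) (V : Ω → Fin d → ℝ) : Prop :=
  IdentDistrib V (fun ω => -V ω) μ μ ∧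
    ∀ t : Fin d → ℝ, 0 < (charFn μ V t).re ∧ (charFn μ V t).im = 0

end Model

end EIV

end

/-!
The matrix `Ω_S⁻¹` only enters through two inequalities. By Cauchy–Schwarz, `Q(θ)` dominates the
square of each component of `S(θ)` divided by the variance of that component at `θ₀`
(`sq_apply_le_mul_quadForm`). For the components of the moment-corrected score this variance is
`O(1 / n)`, so the moment-corrected score at a minimizer `θ̂` is at most of the order
`(Q(θ̂) / n)^(1/2) ≤ (Q(θ₀) / n)^(1/2)`. On the other hand `Q(θ₀)` has mean `dim S + mᵀ Ω_S⁻¹ m`,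
where `m` is the mean of `S(θ₀)`; if `m = O(1 / n)`, then `‖Ω_S⁻¹‖ = o(n³)` makes this `o(n)`
(`tendsto_integral_quadForm_div`). Hence the moment-corrected score at `θ̂` tends to zero in
probability. This score is affine in `θ`, it tends to zero at `θ₀`, and its slope tends to twice the
second moment matrix of the covariates `(X, 1, Z̃)` (`ReducedModel.tendstoInMeasure_corrGram`); as
that matrix is invertible and `Θ` is bounded, `θ̂` tends to `θ₀`
(`ReducedModel.tendstoInMeasure_minimizer`).

Two moments suffice for the moment-corrected score, since the replicate-based estimator of the error
covariance cancels all squares of measurement errors: what remains is a U-statistic in the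
replicates, whose terms are products of independent variables (`modelData_corrSquares`,
`ReducedModel.centeredL2_score`).

The bias `m` comes from the gradient of the phase function discrepancy alone. This gradient is a sum
over pairs of pairs of observations, in which a pair `(i, j)` enters through the difference of the
linear predictor of observation `j` and the outcome of observation `i` (`Data.scoreD_eq`). At `θ₀`
this difference is symmetric about zero, because the errors are and the covariates of different
observations have the same law (`ReducedModel.symm_diff`). Two pairs without a common observation
are independent, and the symmetry makes the mean of their contribution vanish
(`integral_phaseTerm_eq_zero`). The other pairs of pairs have total weight `O(1 / n)`
(`sum_overlap_le`).
-/

namespace EIV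

/-! ### Quadratic forms of an inverse matrix -/

section LinearAlgebra

variable {κ : Type*} [DecidableEq κ]

lemma posDef_of_posSemidef_smul_sub {M : Matrix κ κ ℝ} {N C : ℝ} (hN : 0 < N) (hC : 0 < C)
    (h : (N • M - C • (1 : Matrix κ κ ℝ)).PosSemidef) : M.PosDef := by
  have h1 : (N • M).PosDef := by
    have h2 : (C • (1 : Matrix κ κ ℝ)).PosDef := Matrix.PosDef.one.smul hC
    have := Matrix.PosDef.posSemidef_add h h2
    simpa using this
  have h3 := h1.smul (inv_pos.2 hN)
  simpa [smul_smul, hN.ne'] using h3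

variable [Fintype κ]

lemma mulVec_inv_mulVec {M : Matrix κ κ ℝ} (hM : M.PosDef) (x : κ → ℝ) :
    M *ᵥ (M⁻¹ *ᵥ x) = x := by
  rw [Matrix.mulVec_mulVec, Matrix.mul_nonsing_inv _ ((Matrix.isUnit_iff_isUnit_det _).1 hM.isUnit),
    Matrix.one_mulVec]

lemma quadForm_nonneg {M : Matrix κ κ ℝ} (hM : M.PosDef) (x : κ → ℝ) : 0 ≤ quadForm M x := by
  have := hM.inv.posSemidef.dotProduct_mulVec_nonneg x
  simpa [quadForm] using this

/-- Cauchy–Schwarz for the inner product given by `M`, between a basis vector and `M⁻¹ x`: the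
quadratic form of `M⁻¹` controls every single coordinate. -/
lemma sq_apply_le_mul_quadForm {M : Matrix κ κ ℝ} (hM : M.PosDef) (x : κ → ℝ) (i : κ) :
    x i ^ 2 ≤ M i i * quadForm M x := by
  set z := M⁻¹ *ᵥ x with hz
  have hMz : M *ᵥ z = x := mulVec_inv_mulVec hM x
  have hii : 0 < M i i := hM.diag_pos
  -- the form is nonnegative at `M i i • z - x i • eᵢ`
  have key := hM.posSemidef.dotProduct_mulVec_nonneg (M i i • z - x i • Pi.single i 1)
  have hsymm : ∀ a b, M a b = M b a := fun a b => by
    have := hM.isHermitian.apply b a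
    simpa using this
  have hzM : (Pi.single i (1 : ℝ)) ⬝ᵥ x = x i := by simp
  have h2 : z ⬝ᵥ (M *ᵥ Pi.single i 1) = x i := by
    rw [Matrix.dotProduct_mulVec, ← hMz, dotProduct_single_one]
    simp only [Matrix.vecMul, Matrix.mulVec, dotProduct]
    exact Finset.sum_congr rfl fun a _ => by rw [hsymm a i, mul_comm]
  have h3 : (Pi.single i (1 : ℝ)) ⬝ᵥ (M *ᵥ Pi.single i 1) = M i i := by simp
  have h4 : z ⬝ᵥ x = quadForm M x := by rw [quadForm, dotProduct_comm]
  simp only [star_trivial, Matrix.mulVec_sub, Matrix.mulVec_smul, sub_dotProduct, dotProduct_sub,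
    smul_dotProduct, dotProduct_smul, hMz, hzM, h2, h3, h4, smul_eq_mul] at key
  have : 0 ≤ M i i * (M i i * quadForm M x - x i ^ 2) := by nlinarith
  have := nonneg_of_mul_nonneg_right this hii
  linarith

/-- If `N M ≥ C` as quadratic forms, then `M⁻¹ ≤ N / C`. -/
lemma quadForm_le_of_posSemidef {M : Matrix κ κ ℝ} {N C : ℝ} (hN : 0 < N) (hC : 0 < C)
    (h : (N • M - C • (1 : Matrix κ κ ℝ)).PosSemidef) (x : κ → ℝ) :
    quadForm M x ≤ N / C * (x ⬝ᵥ x) := by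
  have hM := posDef_of_posSemidef_smul_sub hN hC h
  set z := M⁻¹ *ᵥ x with hz
  have hMz : M *ᵥ z = x := mulVec_inv_mulVec hM x
  have key := h.dotProduct_mulVec_nonneg z
  have h4 : z ⬝ᵥ x = quadForm M x := by rw [quadForm, dotProduct_comm]
  simp only [star_trivial, Matrix.sub_mulVec, Matrix.smul_mulVec, Matrix.one_mulVec, hMz,
    dotProduct_sub, dotProduct_smul, smul_eq_mul, h4] at key
  have hcs : quadForm M x ^ 2 ≤ (z ⬝ᵥ z) * (x ⬝ᵥ x) := by
    rw [← h4]
    have := Finset.sum_mul_sq_le_sq_mul_sq Finset.univ z x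
    simpa [dotProduct, sq] using this
  have hx : 0 ≤ x ⬝ᵥ x := by
    simpa using dotProduct_star_self_nonneg x
  have h0 := quadForm_nonneg hM x
  rcases h0.eq_or_lt with h0 | h0
  · rw [← h0]; positivity
  rw [div_mul_eq_mul_div, le_div_iff₀ hC]
  refine le_of_mul_le_mul_right ?_ h0
  nlinarith

lemma quadForm_eq_sum (M : Matrix κ κ ℝ) (x : κ → ℝ) :
    quadForm M x = ∑ a, ∑ b, M⁻¹ a b * (x a * x b) := by
  simp only [quadForm, dotProduct, Matrix.mulVec, Finset.mul_sum]
  exact Finset.sum_congr rfl fun a _ => Finset.sum_congr rfl fun b _ => by ring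

lemma continuous_quadForm (M : Matrix κ κ ℝ) : Continuous (quadForm M) := by
  have : quadForm M = fun x : κ → ℝ => ∑ a, ∑ b, M⁻¹ a b * (x a * x b) :=
    funext (quadForm_eq_sum M)
  rw [this]
  fun_prop

/-- The trace of `M⁻¹ M`, written out for a symmetric positive definite `M`. -/
lemma sum_inv_mul_eq_card {M : Matrix κ κ ℝ} (hM : M.PosDef) :
    ∑ a, ∑ b, M⁻¹ a b * M a b = Fintype.card κ := by
  have hsymm : ∀ a b, M a b = M b a := fun a b => by
    have := hM.isHermitian.apply b a
    simpa using this
  have h1 : (M⁻¹ * M).trace = Fintype.card κ := by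
    rw [Matrix.nonsing_inv_mul _ ((Matrix.isUnit_iff_isUnit_det _).1 hM.isUnit), Matrix.trace_one]
  rw [← h1]
  simp only [Matrix.trace, Matrix.diag, Matrix.mul_apply]
  exact Finset.sum_congr rfl fun a _ => Finset.sum_congr rfl fun b _ => by rw [hsymm a b]

end LinearAlgebra

/-! ### Second moments bounded uniformly over the observations -/

section Moments

variable {Ω : Type*} [MeasurableSpace Ω] {μ : Measure Ω}

lemma memLp_two_mul_of_indepFun {f g : Ω → ℝ} (hfg : IndepFun f g μ) (hf : MemLp f 2 μ)
    (hg : MemLp g 2 μ) :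
    MemLp (fun ω => f ω * g ω) 2 μ ∧
      ∫ ω, (f ω * g ω) ^ 2 ∂μ = (∫ ω, f ω ^ 2 ∂μ) * ∫ ω, g ω ^ 2 ∂μ := by
  have hsq : IndepFun (fun ω => f ω ^ 2) (fun ω => g ω ^ 2) μ :=
    hfg.comp (φ := fun x : ℝ => x ^ 2) (ψ := fun x : ℝ => x ^ 2) (by fun_prop) (by fun_prop)
  have hm : AEStronglyMeasurable (fun ω => f ω * g ω) μ :=
    hf.aestronglyMeasurable.mul hg.aestronglyMeasurable
  have h := hsq.integrable_mul hf.integrable_sq hg.integrable_sq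
  refine ⟨(memLp_two_iff_integrable_sq hm).2 ?_, ?_⟩
  · refine h.congr (ae_of_all _ fun ω => ?_)
    simp [mul_pow]
  · simp only [mul_pow]
    exact hsq.integral_fun_mul_eq_mul_integral (hf.aestronglyMeasurable.pow 2)
      (hg.aestronglyMeasurable.pow 2)

/-- A sequence of real random variables with second moments that are bounded uniformly in the
index. -/
def UniformL2 (μ : Measure Ω) (f : ℕ → Ω → ℝ) : Prop :=
  (∀ j, MemLp (f j) 2 μ) ∧ ∃ C, ∀ j, ∫ ω, f j ω ^ 2 ∂μ ≤ C

/-- A sequence of centered real random variables with uniformly bounded second moments. -/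
def CenteredL2 (μ : Measure Ω) (f : ℕ → Ω → ℝ) : Prop :=
  UniformL2 μ f ∧ ∀ j, ∫ ω, f j ω ∂μ = 0

lemma UniformL2.add {f g : ℕ → Ω → ℝ} (hf : UniformL2 μ f) (hg : UniformL2 μ g) :
    UniformL2 μ (fun j ω => f j ω + g j ω) := by
  obtain ⟨hf, C, hC⟩ := hf
  obtain ⟨hg, D, hD⟩ := hg
  refine ⟨fun j => (hf j).add (hg j), 2 * C + 2 * D, fun j => ?_⟩
  calc ∫ ω, (f j ω + g j ω) ^ 2 ∂μ ≤ ∫ ω, (2 * f j ω ^ 2 + 2 * g j ω ^ 2) ∂μ := by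
        refine integral_mono ((hf j).add (hg j)).integrable_sq
          (((hf j).integrable_sq.const_mul 2).add ((hg j).integrable_sq.const_mul 2)) fun ω => ?_
        simp only
        nlinarith [sq_nonneg (f j ω - g j ω)]
    _ ≤ 2 * C + 2 * D := by
        rw [integral_add ((hf j).integrable_sq.const_mul 2) ((hg j).integrable_sq.const_mul 2),
          integral_const_mul, integral_const_mul]
        linarith [hC j, hD j]

lemma UniformL2.const_mul {f : ℕ → Ω → ℝ} (c : ℝ) (hf : UniformL2 μ f) :
    UniformL2 μ (fun j ω => c * f j ω) := by
  obtain ⟨hf, C, hC⟩ := hf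
  refine ⟨fun j => (hf j).const_mul c, c ^ 2 * C, fun j => ?_⟩
  simp only [mul_pow]
  rw [integral_const_mul]
  exact mul_le_mul_of_nonneg_left (hC j) (sq_nonneg c)

lemma UniformL2.zero : UniformL2 μ (fun _ _ => 0) :=
  ⟨fun _ => MemLp.zero', 0, fun _ => by simp⟩

lemma UniformL2.sum {κ : Type*} {s : Finset κ} {f : κ → ℕ → Ω → ℝ}
    (hf : ∀ i ∈ s, UniformL2 μ (f i)) : UniformL2 μ (fun j ω => ∑ i ∈ s, f i j ω) := by
  classical
  induction s using Finset.induction_on with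
  | empty => simpa using UniformL2.zero
  | insert a s ha ih =>
    simp only [Finset.sum_insert ha]
    exact (hf a (by simp)).add (ih fun i hi => hf i (by simp [hi]))

lemma UniformL2.mul {f g : ℕ → Ω → ℝ} (hf : UniformL2 μ f) (hg : UniformL2 μ g)
    (h : ∀ j, IndepFun (f j) (g j) μ) : UniformL2 μ (fun j ω => f j ω * g j ω) := by
  obtain ⟨hf, C, hC⟩ := hf
  obtain ⟨hg, D, hD⟩ := hg
  refine ⟨fun j => (memLp_two_mul_of_indepFun (h j) (hf j) (hg j)).1, C * D, fun j => ?_⟩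
  rw [(memLp_two_mul_of_indepFun (h j) (hf j) (hg j)).2]
  exact mul_le_mul (hC j) (hD j) (integral_nonneg fun ω => sq_nonneg _)
    ((integral_nonneg fun ω => sq_nonneg _).trans (hC j))

lemma UniformL2.exists_integral_abs_le [IsProbabilityMeasure μ] {f : ℕ → Ω → ℝ}
    (hf : UniformL2 μ f) : ∃ C, 0 ≤ C ∧ ∀ j, ∫ ω, |f j ω| ∂μ ≤ C := by
  obtain ⟨hf, C, hC⟩ := hf
  refine ⟨1 + C, ?_, fun j => ?_⟩
  · linarith [(integral_nonneg fun ω => sq_nonneg (f 0 ω)).trans (hC 0)]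
  calc ∫ ω, |f j ω| ∂μ ≤ ∫ ω, (1 + f j ω ^ 2) ∂μ := by
        refine integral_mono ((hf j).integrable (by norm_num)).abs
          ((integrable_const 1).add (hf j).integrable_sq) fun ω => ?_
        simp only
        nlinarith [sq_nonneg (|f j ω| - 1), sq_abs (f j ω), abs_nonneg (f j ω)]
    _ ≤ 1 + C := by
        rw [integral_add (integrable_const 1) (hf j).integrable_sq]
        simpa using hC j

lemma CenteredL2.add [IsFiniteMeasure μ] {f g : ℕ → Ω → ℝ} (hf : CenteredL2 μ f)
    (hg : CenteredL2 μ g) : CenteredL2 μ (fun j ω => f j ω + g j ω) := by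
  refine ⟨hf.1.add hg.1, fun j => ?_⟩
  rw [integral_add ((hf.1.1 j).integrable (by norm_num)) ((hg.1.1 j).integrable (by norm_num)),
    hf.2 j, hg.2 j, add_zero]

lemma CenteredL2.const_mul {f : ℕ → Ω → ℝ} (c : ℝ) (hf : CenteredL2 μ f) :
    CenteredL2 μ (fun j ω => c * f j ω) :=
  ⟨hf.1.const_mul c, fun j => by rw [integral_const_mul, hf.2 j, mul_zero]⟩

lemma CenteredL2.sub [IsFiniteMeasure μ] {f g : ℕ → Ω → ℝ} (hf : CenteredL2 μ f)
    (hg : CenteredL2 μ g) : CenteredL2 μ (fun j ω => f j ω - g j ω) := by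
  simpa [sub_eq_add_neg] using hf.add (hg.const_mul (-1))

lemma CenteredL2.sum [IsFiniteMeasure μ] {κ : Type*} {s : Finset κ} {f : κ → ℕ → Ω → ℝ}
    (hf : ∀ i ∈ s, CenteredL2 μ (f i)) : CenteredL2 μ (fun j ω => ∑ i ∈ s, f i j ω) := by
  refine ⟨UniformL2.sum fun i hi => (hf i hi).1, fun j => ?_⟩
  rw [integral_finsetSum s fun i hi => ((hf i hi).1.1 j).integrable (by norm_num)]
  exact Finset.sum_eq_zero fun i hi => (hf i hi).2 j

lemma CenteredL2.mul {f g : ℕ → Ω → ℝ} (hf : CenteredL2 μ f) (hg : UniformL2 μ g)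
    (h : ∀ j, IndepFun (f j) (g j) μ) : CenteredL2 μ (fun j ω => f j ω * g j ω) := by
  refine ⟨hf.1.mul hg h, fun j => ?_⟩
  rw [(h j).integral_fun_mul_eq_mul_integral (hf.1.1 j).aestronglyMeasurable
    (hg.1 j).aestronglyMeasurable, hf.2 j, zero_mul]

/-- Sums of independent centered random variables with bounded second moments have variance
`O(n)`. -/
lemma CenteredL2.exists_variance_sum_le [IsProbabilityMeasure μ] {f : ℕ → Ω → ℝ}
    (hf : CenteredL2 μ f) (hind : Pairwise fun i j => IndepFun (f i) (f j) μ) :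
    ∃ C, 0 ≤ C ∧ ∀ n : ℕ, Var[fun ω => ∑ j ∈ Finset.range n, f j ω; μ] ≤ C * n := by
  obtain ⟨⟨hf2, C, hC⟩, h0⟩ := hf
  refine ⟨C, (integral_nonneg fun ω => sq_nonneg (f 0 ω)).trans (hC 0), fun n => ?_⟩
  have h1 : (fun ω => ∑ j ∈ Finset.range n, f j ω) = ∑ j ∈ Finset.range n, f j := by
    ext ω; simp
  rw [h1, IndepFun.variance_sum (fun i _ => hf2 i) fun i _ j _ hij => hind hij]
  calc ∑ j ∈ Finset.range n, Var[f j; μ] ≤ ∑ j ∈ Finset.range n, C := by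
        refine Finset.sum_le_sum fun j _ => ?_
        rw [variance_of_integral_eq_zero (hf2 j).aestronglyMeasurable.aemeasurable (h0 j)]
        exact hC j
    _ = C * n := by simp [mul_comm]

end Moments

/-! ### Convergence in measure to zero -/

section InMeasure

variable {Ω : Type*} [MeasurableSpace Ω] {μ : Measure Ω}

lemma tendstoInMeasure_zero_add {f g : ℕ → Ω → ℝ}
    (hf : TendstoInMeasure μ f atTop fun _ => 0) (hg : TendstoInMeasure μ g atTop fun _ => 0) :
    TendstoInMeasure μ (fun n ω => f n ω + g n ω) atTop fun _ => 0 := by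
  rw [tendstoInMeasure_iff_norm] at *
  intro δ hδ
  have h := (hf (δ / 2) (by positivity)).add (hg (δ / 2) (by positivity))
  rw [add_zero] at h
  refine tendsto_of_tendsto_of_tendsto_of_le_of_le tendsto_const_nhds h (fun n => zero_le)
    fun n => (measure_mono fun ω hω => ?_).trans (measure_union_le _ _)
  simp only [sub_zero, Set.mem_ofPred_eq, Set.mem_union] at hω ⊢
  by_contra! hcon
  linarith [norm_add_le (f n ω) (g n ω), hcon.1, hcon.2]

lemma tendstoInMeasure_zero_sum {κ : Type*} (s : Finset κ) {f : κ → ℕ → Ω → ℝ}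
    (hf : ∀ i ∈ s, TendstoInMeasure μ (f i) atTop fun _ => 0) :
    TendstoInMeasure μ (fun n ω => ∑ i ∈ s, f i n ω) atTop fun _ => 0 := by
  classical
  induction s using Finset.induction_on with
  | empty =>
    rw [tendstoInMeasure_iff_norm]
    intro δ hδ
    simp [hδ.not_ge]
  | insert a s ha ih =>
    simp only [Finset.sum_insert ha]
    exact tendstoInMeasure_zero_add (hf a (by simp)) (ih fun i hi => hf i (by simp [hi]))

/-- Domination: no measurability is needed, since only outer measures are compared. -/
lemma tendstoInMeasure_of_norm_sub_le {E : Type*} [SeminormedAddCommGroup E] {f : ℕ → Ω → E}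
    {e : E} {g : ℕ → Ω → ℝ} (hg : TendstoInMeasure μ g atTop fun _ => 0)
    (h : ∀ᶠ n in atTop, ∀ᵐ ω ∂μ, ‖f n ω - e‖ ≤ g n ω) :
    TendstoInMeasure μ f atTop fun _ => e := by
  rw [tendstoInMeasure_iff_norm] at *
  intro δ hδ
  refine tendsto_of_tendsto_of_tendsto_of_le_of_le' tendsto_const_nhds (hg δ hδ)
    (Eventually.of_forall fun n => zero_le) ?_
  filter_upwards [h] with n hn
  refine measure_mono_ae ?_
  filter_upwards [hn] with ω hω hmem
  have hmem : δ ≤ ‖f n ω - e‖ := hmem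
  change δ ≤ ‖g n ω - 0‖
  rw [sub_zero, Real.norm_eq_abs]
  exact hmem.trans (hω.trans (le_abs_self _))

lemma tendstoInMeasure_zero_const_mul {f : ℕ → Ω → ℝ} (c : ℝ)
    (hf : TendstoInMeasure μ f atTop fun _ => 0) :
    TendstoInMeasure μ (fun n ω => c * f n ω) atTop fun _ => 0 := by
  rw [tendstoInMeasure_iff_norm] at *
  intro δ hδ
  refine tendsto_of_tendsto_of_tendsto_of_le_of_le tendsto_const_nhds
    (hf (δ / (|c| + 1)) (by positivity)) (fun n => zero_le) fun n => measure_mono fun ω hω => ?_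
  simp only [sub_zero, Set.mem_ofPred_eq, norm_mul, Real.norm_eq_abs] at hω ⊢
  rw [div_le_iff₀ (by positivity)]
  nlinarith [abs_nonneg (f n ω)]

lemma tendstoInMeasure_zero_abs {f : ℕ → Ω → ℝ} (hf : TendstoInMeasure μ f atTop fun _ => 0) :
    TendstoInMeasure μ (fun n ω => |f n ω|) atTop fun _ => 0 := by
  rw [tendstoInMeasure_iff_norm] at *
  simpa using hf

/-- Markov's inequality: a nonnegative sequence whose means tend to zero does so in measure, and
so do its square roots. -/
lemma tendstoInMeasure_sqrt_of_tendsto_integral {f : ℕ → Ω → ℝ} [IsFiniteMeasure μ]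
    (hf0 : ∀ᶠ n in atTop, ∀ ω, 0 ≤ f n ω) (hfi : ∀ᶠ n in atTop, Integrable (f n) μ)
    (h : Tendsto (fun n => ∫ ω, f n ω ∂μ) atTop (𝓝 0)) :
    TendstoInMeasure μ (fun n ω => √(f n ω)) atTop fun _ => 0 := by
  rw [tendstoInMeasure_iff_measureReal_norm]
  intro δ hδ
  have h2 := h.const_mul (δ ^ 2)⁻¹
  rw [mul_zero] at h2
  refine tendsto_of_tendsto_of_tendsto_of_le_of_le' tendsto_const_nhds h2
    (Eventually.of_forall fun n => measureReal_nonneg) ?_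
  filter_upwards [hf0, hfi] with n h0 hi
  have hset : {ω | δ ≤ ‖√(f n ω) - 0‖} = {ω | δ ^ 2 ≤ f n ω} := by
    ext ω
    simp only [sub_zero, Real.norm_eq_abs, abs_of_nonneg (Real.sqrt_nonneg _), Set.mem_ofPred_eq]
    exact Real.le_sqrt' hδ
  rw [hset, ← div_eq_inv_mul, le_div_iff₀ (by positivity), mul_comm]
  exact mul_meas_ge_le_integral_of_nonneg (ae_of_all _ h0) hi _

/-- The weak law of large numbers for independent centered random variables with uniformly
bounded second moments. -/
lemma CenteredL2.tendstoInMeasure_average [IsProbabilityMeasure μ] {f : ℕ → Ω → ℝ}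
    (hf : CenteredL2 μ f) (hind : Pairwise fun i j => IndepFun (f i) (f j) μ) :
    TendstoInMeasure μ (fun (n : ℕ) ω => (n : ℝ)⁻¹ * ∑ j ∈ Finset.range n, f j ω) atTop
      fun _ => 0 := by
  obtain ⟨C, hC0, hC⟩ := hf.exists_variance_sum_le hind
  have hmem : ∀ n : ℕ, MemLp (fun ω => ∑ j ∈ Finset.range n, f j ω) 2 μ := fun n =>
    memLp_finsetSum _ fun j _ => hf.1.1 j
  have h0 : ∀ n : ℕ, ∫ ω, ∑ j ∈ Finset.range n, f j ω ∂μ = 0 := fun n =>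
    (CenteredL2.sum (s := Finset.range n) (f := fun j _ => f j)
      fun j _ => ⟨⟨fun _ => hf.1.1 j, _, fun _ => le_rfl⟩, fun _ => hf.2 j⟩).2 0
  have key : TendstoInMeasure μ
      (fun (n : ℕ) ω => √(((n : ℝ)⁻¹ * ∑ j ∈ Finset.range n, f j ω) ^ 2)) atTop fun _ => 0 := by
    refine tendstoInMeasure_sqrt_of_tendsto_integral (.of_forall fun n ω => sq_nonneg _)
      (.of_forall fun n => ((hmem n).const_mul _).integrable_sq) ?_
    refine tendsto_of_tendsto_of_tendsto_of_le_of_le tendsto_const_nhds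
      (tendsto_const_div_atTop_nhds_zero_nat C) (fun n => integral_nonneg fun ω => sq_nonneg _)
      fun n => ?_
    simp only [mul_pow]
    have h1 := hC n
    rw [variance_of_integral_eq_zero (hmem n).aestronglyMeasurable.aemeasurable (h0 n)] at h1
    rw [integral_const_mul]
    rcases n.eq_zero_or_pos with rfl | hn
    · simp
    have hn' : (0 : ℝ) < n := by exact_mod_cast hn
    calc ((n : ℝ)⁻¹) ^ 2 * _ ≤ ((n : ℝ)⁻¹) ^ 2 * (C * n) :=
          mul_le_mul_of_nonneg_left h1 (by positivity)
      _ = C / n := by field_simp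
  refine tendstoInMeasure_of_norm_sub_le key (.of_forall fun n => ae_of_all _ fun ω => ?_)
  rw [sub_zero, Real.sqrt_sq_eq_abs, Real.norm_eq_abs]

end InMeasure

/-! ### The model in terms of covariates and averaged errors -/

section Reduced

variable {Ω : Type*} [MeasurableSpace Ω] {ι : Type*}

/-- The stochastic assumptions on one observation, after averaging the replicates. Here `V j` is
the vector `(X_j, 1, Z̃_j)` of true covariates, `T j` the averaged measurement error, padded by
zeros at the covariates without error, `R j` the part of the bias-corrected matrix of squares of
the observed covariates that is quadratic in the measurement errors (an unbiased estimator of zero),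
and `ε j` the regression error. -/
structure ReducedModel (μ : Measure Ω) (V T : ℕ → Ω → ι → ℝ) (R : ℕ → Ω → ι → ι → ℝ)
    (ε : ℕ → Ω → ℝ) : Prop where
  measurable_V : ∀ j, Measurable (V j)
  measurable_T : ∀ j, Measurable (T j)
  measurable_R : ∀ j, Measurable (R j)
  measurable_ε : ∀ j, Measurable (ε j)
  indep : iIndepFun (fun j ω => (V j ω, T j ω, R j ω, ε j ω)) μ
  indep_error : ∀ j, IndepFun (fun ω => (T j ω, R j ω)) (fun ω => (V j ω, ε j ω)) μ
  indep_V_ε : ∀ j, IndepFun (V j) (ε j) μ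
  identDistrib : ∀ j, IdentDistrib (fun ω => (V j ω, ε j ω)) (fun ω => (V 0 ω, ε 0 ω)) μ μ
  symm_T : ∀ j, IdentDistrib (T j) (fun ω => -T j ω) μ μ
  symm_ε : ∀ j, IdentDistrib (ε j) (fun ω => -ε j ω) μ μ
  uniformL2_V : ∀ a, UniformL2 μ fun j ω => V j ω a
  centeredL2_T : ∀ a, CenteredL2 μ fun j ω => T j ω a
  centeredL2_R : ∀ a b, CenteredL2 μ fun j ω => R j ω a b
  centeredL2_ε : CenteredL2 μ ε

/-- The bias-corrected matrix of squares of the observed covariates `V + T`. -/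
def corrGram (V T : ι → ℝ) (R : ι → ι → ℝ) (a b : ι) : ℝ :=
  V a * V b + V a * T b + T a * V b + R a b

/-- The moment-corrected score, for bias-corrected matrices of squares `H`, covariates `A` and
outcomes `y`. -/
noncomputable def linScore [Fintype ι] (H : ℕ → ι → ι → ℝ) (A : ℕ → ι → ℝ) (y : ℕ → ℝ) (n : ℕ) (θ : ι → ℝ) (a : ι) : ℝ :=
  2 / (n : ℝ) * ∑ j ∈ Finset.range n, (∑ b, H j a b * θ b - y j * A j a)

/-- The moment-corrected score is affine in the parameter. -/
lemma linScore_sub [Fintype ι] (H : ℕ → ι → ι → ℝ) (A : ℕ → ι → ℝ) (y : ℕ → ℝ) (n : ℕ) (θ θ' : ι → ℝ)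
    (a : ι) : linScore H A y n θ a - linScore H A y n θ' a =
      2 * ∑ b, ((n : ℝ)⁻¹ * ∑ j ∈ Finset.range n, H j a b) * (θ b - θ' b) := by
  have h : ∀ b, ((n : ℝ)⁻¹ * ∑ j ∈ Finset.range n, H j a b) * (θ b - θ' b) =
      ∑ j ∈ Finset.range n, (n : ℝ)⁻¹ * (H j a b * θ b - H j a b * θ' b) := fun b => by
    rw [mul_assoc, Finset.sum_mul, Finset.mul_sum]
    exact Finset.sum_congr rfl fun j _ => by ring
  simp only [h, linScore]
  rw [← mul_sub, ← Finset.sum_sub_distrib, Finset.sum_comm, Finset.mul_sum, Finset.mul_sum]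
  refine Finset.sum_congr rfl fun j _ => ?_
  rw [← Finset.mul_sum, Finset.sum_sub_distrib]
  ring

variable {μ : Measure Ω} {V T : ℕ → Ω → ι → ℝ} {R : ℕ → Ω → ι → ι → ℝ} {ε : ℕ → Ω → ℝ}

namespace ReducedModel

lemma indepFun_comp (h : ReducedModel μ V T R ε) {β : Type*} [MeasurableSpace β]
    {φ : (ι → ℝ) × (ι → ℝ) × (ι → ι → ℝ) × ℝ → β} (hφ : Measurable φ) :
    Pairwise fun i j => IndepFun (fun ω => φ (V i ω, T i ω, R i ω, ε i ω))
      (fun ω => φ (V j ω, T j ω, R j ω, ε j ω)) μ := fun _ _ hij =>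
  (h.indep.indepFun hij).comp hφ hφ

lemma indepFun_T_V (h : ReducedModel μ V T R ε) (a b : ι) (j : ℕ) :
    IndepFun (fun ω => T j ω a) (fun ω => V j ω b) μ :=
  (h.indep_error j).comp (φ := fun x : (ι → ℝ) × (ι → ι → ℝ) => x.1 a)
    (ψ := fun x : (ι → ℝ) × ℝ => x.1 b) (by fun_prop) (by fun_prop)

lemma indepFun_T_ε (h : ReducedModel μ V T R ε) (a : ι) (j : ℕ) :
    IndepFun (fun ω => T j ω a) (ε j) μ :=
  (h.indep_error j).comp (φ := fun x : (ι → ℝ) × (ι → ι → ℝ) => x.1 a)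
    (ψ := fun x : (ι → ℝ) × ℝ => x.2) (by fun_prop) (by fun_prop)

lemma indepFun_ε_V (h : ReducedModel μ V T R ε) (a : ι) (j : ℕ) :
    IndepFun (ε j) (fun ω => V j ω a) μ :=
  ((h.indep_V_ε j).comp (φ := fun x : ι → ℝ => x a) (ψ := fun x : ℝ => x)
    (by fun_prop) (by fun_prop)).symm

/-- The average of the bias-corrected matrices of squares is a consistent estimator of the second
moment matrix of the true covariates: the part without errors obeys Khinchin's law of large
numbers, and the rest is centered with bounded second moments. -/
lemma tendstoInMeasure_corrGram [IsProbabilityMeasure μ] (h : ReducedModel μ V T R ε) (a b : ι) :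
    TendstoInMeasure μ (fun (n : ℕ) ω =>
      (n : ℝ)⁻¹ * ∑ j ∈ Finset.range n, corrGram (V j ω) (T j ω) (R j ω) a b
        - ∫ ω, V 0 ω a * V 0 ω b ∂μ) atTop fun _ => 0 := by
  have hc : CenteredL2 μ fun j ω => T j ω b * V j ω a + T j ω a * V j ω b + R j ω a b :=
    (((h.centeredL2_T b).mul (h.uniformL2_V a) (h.indepFun_T_V b a)).add
      ((h.centeredL2_T a).mul (h.uniformL2_V b) (h.indepFun_T_V a b))).add (h.centeredL2_R a b)
  have h1 := hc.tendstoInMeasure_average (h.indepFun_comp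
    (φ := fun x => x.2.1 b * x.1 a + x.2.1 a * x.1 b + x.2.2.1 a b) (by fun_prop))
  have hint : Integrable (fun ω => V 0 ω a * V 0 ω b) μ :=
    ((h.uniformL2_V a).1 0).integrable_mul ((h.uniformL2_V b).1 0)
  have hmeas : ∀ j, Measurable fun ω => V j ω a * V j ω b := fun j => by
    have := h.measurable_V j
    fun_prop
  have h2 := strong_law_Lp (μ := μ) (p := 1) le_rfl (by norm_num)
    (fun j ω => V j ω a * V j ω b) (memLp_one_iff_integrable.2 hint)
    (h.indepFun_comp (φ := fun x => x.1 a * x.1 b) (by fun_prop))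
    fun j => (h.identDistrib j).comp (u := fun x : (ι → ℝ) × ℝ => x.1 a * x.1 b) (by fun_prop)
  have h3 : TendstoInMeasure μ (fun (n : ℕ) ω =>
      (n : ℝ)⁻¹ • (∑ j ∈ Finset.range n, V j ω a * V j ω b) - ∫ ω, V 0 ω a * V 0 ω b ∂μ)
      atTop fun _ => 0 := by
    refine tendstoInMeasure_of_tendsto_eLpNorm (p := 1) (by norm_num) (fun n => ?_)
      aestronglyMeasurable_const ?_
    · have : Measurable fun ω => (n : ℝ)⁻¹ • (∑ j ∈ Finset.range n, V j ω a * V j ω b)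
          - ∫ ω, V 0 ω a * V 0 ω b ∂μ := by fun_prop
      exact this.aestronglyMeasurable
    · convert h2 using 3 with n
      ext ω
      simp
  convert tendstoInMeasure_zero_add h3 h1 using 3 with n ω
  rw [smul_eq_mul, sub_add_eq_add_sub, ← mul_add, ← Finset.sum_add_distrib]
  congr 2
  refine Finset.sum_congr rfl fun j _ => ?_
  simp only [corrGram]
  ring

variable [Fintype ι]

lemma indepFun_score (h : ReducedModel μ V T R ε) (θ₀ : ι → ℝ) (a : ι) :
    Pairwise fun i j => IndepFun
      (fun ω => ∑ b, corrGram (V i ω) (T i ω) (R i ω) a b * θ₀ b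
        - (V i ω ⬝ᵥ θ₀ + ε i ω) * (V i ω a + T i ω a))
      (fun ω => ∑ b, corrGram (V j ω) (T j ω) (R j ω) a b * θ₀ b
        - (V j ω ⬝ᵥ θ₀ + ε j ω) * (V j ω a + T j ω a)) μ :=
  h.indepFun_comp (φ := fun x => ∑ b, corrGram x.1 x.2.1 x.2.2.1 a b * θ₀ b
    - (x.1 ⬝ᵥ θ₀ + x.2.2.2) * (x.1 a + x.2.1 a)) (by
      simp only [corrGram, dotProduct]
      fun_prop)

variable [IsProbabilityMeasure μ]

/-- The summands of the moment-corrected score at the true parameter are centered, and two moments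
of the errors suffice for their second moments, as they only contain products of independent
variables. -/
lemma centeredL2_score (h : ReducedModel μ V T R ε) (θ₀ : ι → ℝ) (a : ι) :
    CenteredL2 μ fun j ω => ∑ b, corrGram (V j ω) (T j ω) (R j ω) a b * θ₀ b
      - (V j ω ⬝ᵥ θ₀ + ε j ω) * (V j ω a + T j ω a) := by
  have h1 : CenteredL2 μ fun j ω => ∑ b, (θ₀ b * (T j ω b * V j ω a) + θ₀ b * R j ω a b) :=
    CenteredL2.sum fun b _ =>
      (((h.centeredL2_T b).mul (h.uniformL2_V a) (h.indepFun_T_V b a)).const_mul _).add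
        ((h.centeredL2_R a b).const_mul _)
  have h2 := h.centeredL2_ε.mul (h.uniformL2_V a) (h.indepFun_ε_V a)
  have h3 := (h.centeredL2_T a).mul h.centeredL2_ε.1 (h.indepFun_T_ε a)
  convert h1.sub (h2.add h3) using 3 with j ω
  have : ∀ b, corrGram (V j ω) (T j ω) (R j ω) a b * θ₀ b =
      (θ₀ b * (T j ω b * V j ω a) + θ₀ b * R j ω a b) + (V j ω a + T j ω a) * (V j ω b * θ₀ b) :=
    fun b => by simp only [corrGram]; ring
  simp only [this]
  rw [Finset.sum_add_distrib, ← Finset.mul_sum, dotProduct]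
  ring

lemma memLp_linScore (h : ReducedModel μ V T R ε) (θ₀ : ι → ℝ) (n : ℕ) (a : ι) :
    MemLp (fun ω => linScore (fun j => corrGram (V j ω) (T j ω) (R j ω))
      (fun j a => V j ω a + T j ω a) (fun j => V j ω ⬝ᵥ θ₀ + ε j ω) n θ₀ a) 2 μ :=
  (memLp_finsetSum _ fun j _ => (h.centeredL2_score θ₀ a).1.1 j).const_mul _

lemma integral_linScore (h : ReducedModel μ V T R ε) (θ₀ : ι → ℝ) (n : ℕ) (a : ι) :
    ∫ ω, linScore (fun j => corrGram (V j ω) (T j ω) (R j ω))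
      (fun j a => V j ω a + T j ω a) (fun j => V j ω ⬝ᵥ θ₀ + ε j ω) n θ₀ a ∂μ = 0 := by
  simp only [linScore]
  have hs := h.centeredL2_score θ₀ a
  rw [integral_const_mul, integral_finsetSum _ fun j _ => (hs.1.1 j).integrable (by norm_num),
    Finset.sum_eq_zero fun j _ => hs.2 j, mul_zero]

lemma exists_variance_linScore_le (h : ReducedModel μ V T R ε) (θ₀ : ι → ℝ) (a : ι) :
    ∃ C, 0 ≤ C ∧ ∀ n : ℕ, Var[fun ω => linScore (fun j => corrGram (V j ω) (T j ω) (R j ω))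
      (fun j a => V j ω a + T j ω a) (fun j => V j ω ⬝ᵥ θ₀ + ε j ω) n θ₀ a; μ] ≤ C / n := by
  obtain ⟨C, hC0, hC⟩ := (h.centeredL2_score θ₀ a).exists_variance_sum_le (h.indepFun_score θ₀ a)
  refine ⟨4 * C, by positivity, fun n => ?_⟩
  simp only [linScore]
  rw [variance_const_mul]
  rcases n.eq_zero_or_pos with rfl | hn
  · simp
  have hn' : (0 : ℝ) < n := by exact_mod_cast hn
  calc (2 / (n : ℝ)) ^ 2 * _ ≤ (2 / (n : ℝ)) ^ 2 * (C * n) :=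
        mul_le_mul_of_nonneg_left (hC n) (by positivity)
    _ = 4 * C / n := by field_simp; ring

lemma tendstoInMeasure_linScore (h : ReducedModel μ V T R ε) (θ₀ : ι → ℝ) (a : ι) :
    TendstoInMeasure μ (fun n ω => linScore (fun j => corrGram (V j ω) (T j ω) (R j ω))
      (fun j a => V j ω a + T j ω a) (fun j => V j ω ⬝ᵥ θ₀ + ε j ω) n θ₀ a) atTop
      fun _ => 0 := by
  have := tendstoInMeasure_zero_const_mul 2
    ((h.centeredL2_score θ₀ a).tendstoInMeasure_average (h.indepFun_score θ₀ a))
  simpa only [linScore, div_eq_mul_inv, mul_assoc] using this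

end ReducedModel

end Reduced

/-! ### The bias of the phase function score -/

section Symmetry

variable {Ω : Type*} [MeasurableSpace Ω] {μ : Measure Ω} [IsProbabilityMeasure μ]

lemma integral_eq_zero_of_symm {β : Type*} [MeasurableSpace β] {Y : Ω → β} {x : Ω → ℝ}
    (hY : Measurable Y) (hYx : IndepFun Y x μ) (hx : IdentDistrib x (fun ω => -x ω) μ μ)
    {F : β × ℝ → ℝ} (hF : Measurable F) (hodd : ∀ y s, F (y, -s) = -F (y, s)) :
    ∫ ω, F (Y ω, x ω) ∂μ = 0 := by
  have h1 : IndepFun Y (fun ω => -x ω) μ :=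
    hYx.comp (φ := fun y : β => y) (ψ := fun s : ℝ => -s) measurable_id measurable_neg
  have h2 := ((IdentDistrib.refl hY.aemeasurable).prodMk hx hYx h1).comp hF
  have h3 := h2.integral_eq
  simp only [Function.comp_def, hodd, integral_neg] at h3
  linarith

lemma identDistrib_sub_neg_of_symm {x y : Ω → ℝ} (hxy : IndepFun x y μ)
    (hx : IdentDistrib x (fun ω => -x ω) μ μ) (hy : IdentDistrib y (fun ω => -y ω) μ μ) :
    IdentDistrib (fun ω => x ω - y ω) (fun ω => -(x ω - y ω)) μ μ := by
  have h1 : IndepFun (fun ω => -x ω) (fun ω => -y ω) μ :=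
    hxy.comp (φ := fun s : ℝ => -s) (ψ := fun s : ℝ => -s) measurable_neg measurable_neg
  have h2 := (hx.prodMk hy hxy h1).comp (u := fun p : ℝ × ℝ => p.1 - p.2) (by fun_prop)
  convert h2 using 1
  · rfl
  · ext ω
    simp only [Function.comp_apply]
    ring

/-- Let `v + t` and `v' + e` be independent, where `v` and `v'` have the same law, `t` and `e` are
symmetric, `v` is independent of `t`, and `v'` of `e`. Then the difference is symmetric, as both it
and its negative have the law `law v ∗ law (-v) ∗ law t ∗ law e`. -/
lemma identDistrib_sub_neg_of_add {v t v' e : Ω → ℝ} (hv : Measurable v) (ht : Measurable t)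
    (hv' : Measurable v') (he : Measurable e) (hvt : IndepFun v t μ) (hve : IndepFun v' e μ)
    (hid : IdentDistrib v v' μ μ) (hst : IdentDistrib t (fun ω => -t ω) μ μ)
    (hse : IdentDistrib e (fun ω => -e ω) μ μ)
    (hind : IndepFun (fun ω => v ω + t ω) (fun ω => v' ω + e ω) μ) :
    IdentDistrib (fun ω => (v ω + t ω) - (v' ω + e ω))
      (fun ω => -((v ω + t ω) - (v' ω + e ω))) μ μ := by
  have hneg : Measurable fun s : ℝ => -s := measurable_neg
  have hid' := hid.comp hneg
  have conv : ∀ {f g : Ω → ℝ}, Measurable f → Measurable g → IndepFun f g μ →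
      μ.map (fun ω => f ω + g ω) = (μ.map f) ∗ (μ.map g) := fun hf hg h =>
    h.map_add_eq_map_conv_map₀ hf.aemeasurable hg.aemeasurable
  have h1 := conv hv ht hvt
  have h2 := conv hv' he hve
  have h3 := conv hv.neg ht.neg (hvt.comp hneg hneg)
  have h4 := conv hv'.neg he.neg (hve.comp hneg hneg)
  have h5 := conv (hv.add ht) (hv'.neg.add he.neg) (by
    convert hind.comp measurable_id hneg using 1
    · rfl
    · ext ω; simp [add_comm])
  have h6 := conv (hv'.add he) (hv.neg.add ht.neg) (by
    convert hind.symm.comp measurable_id hneg using 1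
    · rfl
    · ext ω; simp [add_comm])
  have et : μ.map (-t) = μ.map t := hst.map_eq.symm
  have ee : μ.map (-e) = μ.map e := hse.map_eq.symm
  have ev : μ.map v' = μ.map v := hid.map_eq.symm
  have evn : μ.map (-v') = μ.map (-v) := hid'.map_eq.symm
  refine ⟨by fun_prop, by fun_prop, ?_⟩
  have hv1 : IsProbabilityMeasure (μ.map v) := Measure.isProbabilityMeasure_map hv.aemeasurable
  have hv2 : IsProbabilityMeasure (μ.map (-v)) :=
    Measure.isProbabilityMeasure_map hv.neg.aemeasurable
  have hv3 : IsProbabilityMeasure (μ.map t) := Measure.isProbabilityMeasure_map ht.aemeasurable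
  have hv4 : IsProbabilityMeasure (μ.map e) := Measure.isProbabilityMeasure_map he.aemeasurable
  have e5 : (fun ω => (v ω + t ω) - (v' ω + e ω)) = fun ω => (v + t) ω + (-v' + -e) ω := by
    ext ω; simp; ring
  have e6 : (fun ω => -((v ω + t ω) - (v' ω + e ω))) = fun ω => (v' + e) ω + (-v + -t) ω := by
    ext ω; simp; ring
  have f1 : μ.map (v + t) = (μ.map v) ∗ (μ.map t) := h1
  have f2 : μ.map (v' + e) = (μ.map v) ∗ (μ.map e) := by rw [← ev]; exact h2
  have f3 : μ.map (-v + -t) = (μ.map (-v)) ∗ (μ.map t) := by rw [← et]; exact h3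
  have f4 : μ.map (-v' + -e) = (μ.map (-v)) ∗ (μ.map e) := by rw [← ee, ← evn]; exact h4
  rw [e5, e6, h5, h6, f1, f2, f3, f4, Measure.conv_assoc (μ.map v) (μ.map t),
    Measure.conv_assoc (μ.map v) (μ.map e), Measure.conv_comm (μ.map t) (μ.map (-v) ∗ μ.map e),
    Measure.conv_comm (μ.map (-v)) (μ.map e), Measure.conv_assoc (μ.map e)]

end Symmetry

section Phase

/-- The contribution of two pairs of observations to a partial derivative of the phase function
discrepancy. A pair consists of the outcome of one observation and the linear predictor of another;
`x`, `x'` are the differences of predictor and outcome in the two pairs, and `u`, `u'` the values of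
the covariate. The function `σ` stands for `x ↦ ∫ t sin (t x) K(t) dt`. -/
def phaseTerm (σ : ℝ → ℝ) (x x' u u' : ℝ) : ℝ :=
  u * (σ (x + x') - σ (x - x')) + u' * (σ (x + x') + σ (x - x'))

/-- The gradient of the phase function discrepancy, for covariates `A`, outcomes `y` and weights
`w`, as a sum over pairs of pairs of observations. -/
noncomputable def phaseGrad {ι : Type*} [Fintype ι] (σ : ℝ → ℝ) (w : ℕ → ℝ) (A : ℕ → ι → ℝ)
    (y : ℕ → ℝ) (n : ℕ) (θ : ι → ℝ) (a : ι) : ℝ :=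
  ∑ i ∈ Finset.range n, ∑ j ∈ Finset.range n, ∑ k ∈ Finset.range n, ∑ l ∈ Finset.range n,
    ((n : ℝ)⁻¹ ^ 2 * w j * w l / 2) *
      phaseTerm σ (A j ⬝ᵥ θ - y i) (A l ⬝ᵥ θ - y k) (A j a) (A l a)

lemma continuous_phaseGrad {ι : Type*} [Fintype ι] {σ : ℝ → ℝ} (hσ : Continuous σ) (w : ℕ → ℝ)
    (A : ℕ → ι → ℝ) (y : ℕ → ℝ) (n : ℕ) (a : ι) :
    Continuous fun θ => phaseGrad σ w A y n θ a := by
  simp only [phaseGrad, phaseTerm, dotProduct]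
  fun_prop

lemma abs_phaseTerm_le {σ : ℝ → ℝ} {L : ℝ} (hL : ∀ x, |σ x| ≤ L) (x x' u u' : ℝ) :
    |phaseTerm σ x x' u u'| ≤ 2 * L * (|u| + |u'|) := by
  have h1 := (abs_sub (σ (x + x')) (σ (x - x'))).trans (add_le_add (hL _) (hL _))
  have h2 := (abs_add_le (σ (x + x')) (σ (x - x'))).trans (add_le_add (hL _) (hL _))
  calc |phaseTerm σ x x' u u'|
      ≤ |u| * |σ (x + x') - σ (x - x')| + |u'| * |σ (x + x') + σ (x - x')| := by
        rw [← abs_mul, ← abs_mul]; exact abs_add_le _ _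
    _ ≤ |u| * (L + L) + |u'| * (L + L) := by gcongr
    _ = 2 * L * (|u| + |u'|) := by ring

variable {Ω : Type*} [MeasurableSpace Ω] {μ : Measure Ω}

/-- For two pairs without a common observation, the contribution to the gradient has mean zero: one
half of it is odd in the symmetric variable `x'`, the other half is odd in `x`. -/
lemma integral_phaseTerm_eq_zero [IsProbabilityMeasure μ] {σ : ℝ → ℝ} (hσ : Measurable σ) {L : ℝ} (hL : ∀ x, |σ x| ≤ L)
    (hodd : ∀ x, σ (-x) = -σ x) {x x' u u' : Ω → ℝ} (hx : Measurable x) (hx' : Measurable x')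
    (hu : Measurable u) (hu' : Measurable u') (hui : Integrable u μ) (hui' : Integrable u' μ)
    (hind : IndepFun (fun ω => (x ω, u ω)) (fun ω => (x' ω, u' ω)) μ)
    (hsx : IdentDistrib x (fun ω => -x ω) μ μ) (hsx' : IdentDistrib x' (fun ω => -x' ω) μ μ) :
    ∫ ω, phaseTerm σ (x ω) (x' ω) (u ω) (u' ω) ∂μ = 0 := by
  have hi1 : Integrable (fun ω => u ω * (σ (x ω + x' ω) - σ (x ω - x' ω))) μ := by
    refine hui.mul_bdd (c := L + L) (by fun_prop) (ae_of_all _ fun ω => ?_)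
    exact (abs_sub _ _).trans (add_le_add (hL _) (hL _))
  have hi2 : Integrable (fun ω => u' ω * (σ (x ω + x' ω) + σ (x ω - x' ω))) μ := by
    refine hui'.mul_bdd (c := L + L) (by fun_prop) (ae_of_all _ fun ω => ?_)
    exact (abs_add_le _ _).trans (add_le_add (hL _) (hL _))
  have h1 : ∫ ω, u ω * (σ (x ω + x' ω) - σ (x ω - x' ω)) ∂μ = 0 := by
    refine integral_eq_zero_of_symm (Y := fun ω => (x ω, u ω)) (x := x') (hx.prodMk hu)
      (hind.comp (φ := fun p : ℝ × ℝ => p) (ψ := fun p : ℝ × ℝ => p.1) measurable_id measurable_fst)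
      hsx' (F := fun p => p.1.2 * (σ (p.1.1 + p.2) - σ (p.1.1 - p.2))) (by fun_prop)
      fun p s => ?_
    simp only [← sub_eq_add_neg, sub_neg_eq_add]
    ring
  have h2 : ∫ ω, u' ω * (σ (x ω + x' ω) + σ (x ω - x' ω)) ∂μ = 0 := by
    refine integral_eq_zero_of_symm (Y := fun ω => (x' ω, u' ω)) (x := x) (hx'.prodMk hu')
      (hind.symm.comp (φ := fun p : ℝ × ℝ => p) (ψ := fun p : ℝ × ℝ => p.1) measurable_id
        measurable_fst)
      hsx (F := fun p => p.1.2 * (σ (p.2 + p.1.1) + σ (p.2 - p.1.1))) (by fun_prop)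
      fun p s => ?_
    have e1 : -s + p.1 = -(s - p.1) := by ring
    have e2 : -s - p.1 = -(s + p.1) := by ring
    simp only [e1, e2, hodd]
    ring
  simp only [phaseTerm]
  rw [integral_add hi1 hi2, h1, h2, add_zero]

/-- The pairs of pairs of observations that have an observation in common carry a total weight of
order `1 / n`. -/
lemma sum_overlap_le {n : ℕ} {w : ℕ → ℝ} {C : ℝ} (hw0 : ∀ j < n, 0 ≤ w j)
    (hw1 : ∑ j ∈ Finset.range n, w j = 1) (hwmax : ∀ j < n, w j ≤ C / n) :
    ∑ i ∈ Finset.range n, ∑ j ∈ Finset.range n, ∑ k ∈ Finset.range n, ∑ l ∈ Finset.range n,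
      ((n : ℝ)⁻¹ ^ 2 * w j * w l / 2) * ((if i = k then 1 else 0) + (if i = l then 1 else 0)
        + (if j = k then 1 else 0) + (if j = l then 1 else 0)) ≤ (3 + C) / (2 * n) := by
  rcases n.eq_zero_or_pos with rfl | hn
  · simp
  have hn' : (0 : ℝ) < n := by exact_mod_cast hn
  have hsq : ∑ j ∈ Finset.range n, w j * w j ≤ C / n := by
    calc ∑ j ∈ Finset.range n, w j * w j ≤ ∑ j ∈ Finset.range n, w j * (C / n) :=
          Finset.sum_le_sum fun j hj => mul_le_mul_of_nonneg_left (hwmax j (Finset.mem_range.1 hj))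
            (hw0 j (Finset.mem_range.1 hj))
      _ = C / n := by rw [← Finset.sum_mul, hw1, one_mul]
  have e1 : ∑ i ∈ Finset.range n, ∑ j ∈ Finset.range n, ∑ k ∈ Finset.range n,
      ∑ l ∈ Finset.range n, ((n : ℝ)⁻¹ ^ 2 * w j * w l / 2) * (if i = k then 1 else 0) =
      (2 * (n : ℝ))⁻¹ := by
    simp only [mul_ite, mul_one, mul_zero]
    have : ∀ i ∈ Finset.range n, ∀ j, ∑ k ∈ Finset.range n, ∑ l ∈ Finset.range n,
        (if i = k then (n : ℝ)⁻¹ ^ 2 * w j * w l / 2 else 0) = (n : ℝ)⁻¹ ^ 2 / 2 * w j := by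
      intro i hi j
      rw [Finset.sum_comm]
      simp only [Finset.sum_ite_eq, hi, if_true]
      rw [← Finset.sum_div, ← Finset.mul_sum, hw1]
      ring
    rw [Finset.sum_congr rfl fun i hi => Finset.sum_congr rfl fun j _ => this i hi j]
    simp only [← Finset.mul_sum, hw1, Finset.sum_const, Finset.card_range, nsmul_eq_mul]
    field_simp
  have e2 : ∑ i ∈ Finset.range n, ∑ j ∈ Finset.range n, ∑ k ∈ Finset.range n,
      ∑ l ∈ Finset.range n, ((n : ℝ)⁻¹ ^ 2 * w j * w l / 2) * (if i = l then 1 else 0) =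
      (2 * (n : ℝ))⁻¹ := by
    simp only [mul_ite, mul_one, mul_zero]
    have : ∀ i ∈ Finset.range n, ∀ j, ∑ k ∈ Finset.range n, ∑ l ∈ Finset.range n,
        (if i = l then (n : ℝ)⁻¹ ^ 2 * w j * w l / 2 else 0) = (n : ℝ)⁻¹ / 2 * w i * w j := by
      intro i hi j
      simp only [Finset.sum_ite_eq, hi, if_true, Finset.sum_const, Finset.card_range, nsmul_eq_mul]
      field_simp
    rw [Finset.sum_congr rfl fun i hi => Finset.sum_congr rfl fun j _ => this i hi j]
    simp only [← Finset.mul_sum, hw1, mul_one]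
    field_simp
  have e3 : ∑ i ∈ Finset.range n, ∑ j ∈ Finset.range n, ∑ k ∈ Finset.range n,
      ∑ l ∈ Finset.range n, ((n : ℝ)⁻¹ ^ 2 * w j * w l / 2) * (if j = k then 1 else 0) =
      (2 * (n : ℝ))⁻¹ := by
    simp only [mul_ite, mul_one, mul_zero]
    have : ∀ j ∈ Finset.range n, ∑ k ∈ Finset.range n, ∑ l ∈ Finset.range n,
        (if j = k then (n : ℝ)⁻¹ ^ 2 * w j * w l / 2 else 0) = (n : ℝ)⁻¹ ^ 2 / 2 * w j := by
      intro j hj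
      rw [Finset.sum_comm]
      simp only [Finset.sum_ite_eq, hj, if_true]
      rw [← Finset.sum_div, ← Finset.mul_sum, hw1]
      ring
    rw [Finset.sum_congr rfl fun i _ => Finset.sum_congr rfl fun j hj => this j hj]
    simp only [← Finset.mul_sum, hw1, Finset.sum_const, Finset.card_range, nsmul_eq_mul]
    field_simp
  have e4 : ∑ i ∈ Finset.range n, ∑ j ∈ Finset.range n, ∑ k ∈ Finset.range n,
      ∑ l ∈ Finset.range n, ((n : ℝ)⁻¹ ^ 2 * w j * w l / 2) * (if j = l then 1 else 0) =
      (∑ j ∈ Finset.range n, w j * w j) / 2 := by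
    simp only [mul_ite, mul_one, mul_zero]
    have : ∀ j ∈ Finset.range n, ∑ k ∈ Finset.range n, ∑ l ∈ Finset.range n,
        (if j = l then (n : ℝ)⁻¹ ^ 2 * w j * w l / 2 else 0) = (n : ℝ)⁻¹ / 2 * (w j * w j) := by
      intro j hj
      simp only [Finset.sum_ite_eq, hj, if_true, Finset.sum_const, Finset.card_range, nsmul_eq_mul]
      field_simp
    rw [Finset.sum_congr rfl fun i _ => Finset.sum_congr rfl fun j hj => this j hj]
    simp only [← Finset.mul_sum, Finset.sum_const, Finset.card_range, nsmul_eq_mul]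
    field_simp
  simp only [mul_add, Finset.sum_add_distrib, e1, e2, e3, e4]
  have : (3 + C) / (2 * n) = (2 * (n : ℝ))⁻¹ + (2 * (n : ℝ))⁻¹ + (2 * (n : ℝ))⁻¹ + C / n / 2 := by
    field_simp; ring
  linarith

namespace ReducedModel

variable {ι : Type*} {V T : ℕ → Ω → ι → ℝ} {R : ℕ → Ω → ι → ι → ℝ} {ε : ℕ → Ω → ℝ}

lemma uniformL2_obs (h : ReducedModel μ V T R ε) (a : ι) :
    UniformL2 μ fun j ω => V j ω a + T j ω a :=
  (h.uniformL2_V a).add (h.centeredL2_T a).1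

lemma measurable_obs (h : ReducedModel μ V T R ε) (a : ι) (j : ℕ) :
    Measurable fun ω => V j ω a + T j ω a := by
  have := h.measurable_V j
  have := h.measurable_T j
  fun_prop

variable [Fintype ι]

lemma measurable_diff (h : ReducedModel μ V T R ε) (θ₀ : ι → ℝ) (i j : ℕ) :
    Measurable fun ω => (fun a => V j ω a + T j ω a) ⬝ᵥ θ₀ - (V i ω ⬝ᵥ θ₀ + ε i ω) := by
  have := h.measurable_V j
  have := h.measurable_V i
  have := h.measurable_T j
  have := h.measurable_ε i
  simp only [dotProduct]
  fun_prop

lemma indepFun_diff (h : ReducedModel μ V T R ε) (θ₀ : ι → ℝ) (a : ι) {i j k l : ℕ}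
    (hik : i ≠ k) (hil : i ≠ l) (hjk : j ≠ k) (hjl : j ≠ l) :
    IndepFun (fun ω => ((fun a => V j ω a + T j ω a) ⬝ᵥ θ₀ - (V i ω ⬝ᵥ θ₀ + ε i ω),
        V j ω a + T j ω a))
      (fun ω => ((fun a => V l ω a + T l ω a) ⬝ᵥ θ₀ - (V k ω ⬝ᵥ θ₀ + ε k ω),
        V l ω a + T l ω a)) μ := by
  have hm : ∀ j, Measurable fun ω => (V j ω, T j ω, R j ω, ε j ω) := fun j =>
    (h.measurable_V j).prodMk ((h.measurable_T j).prodMk ((h.measurable_R j).prodMk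
      (h.measurable_ε j)))
  have hd : Disjoint ({i, j} : Finset ℕ) {k, l} := by
    simp [Finset.disjoint_left, *]
  have key := h.indep.indepFun_finset {i, j} {k, l} hd hm
  have hφ : ∀ (i j : ℕ), Measurable
      fun f : (({i, j} : Finset ℕ) → (ι → ℝ) × (ι → ℝ) × (ι → ι → ℝ) × ℝ) =>
        ((fun a => (f ⟨j, by simp⟩).1 a + (f ⟨j, by simp⟩).2.1 a) ⬝ᵥ θ₀ -
          ((f ⟨i, by simp⟩).1 ⬝ᵥ θ₀ + (f ⟨i, by simp⟩).2.2.2),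
          (f ⟨j, by simp⟩).1 a + (f ⟨j, by simp⟩).2.1 a) := fun i j => by
    simp only [dotProduct]
    fun_prop
  exact key.comp (hφ i j) (hφ k l)

lemma memLp_phaseTerm (h : ReducedModel μ V T R ε) {σ : ℝ → ℝ} (hσ : Measurable σ) {L : ℝ}
    (hL : ∀ x, |σ x| ≤ L) (θ₀ : ι → ℝ) (a : ι) (i j k l : ℕ) :
    MemLp (fun ω => phaseTerm σ ((fun a => V j ω a + T j ω a) ⬝ᵥ θ₀ - (V i ω ⬝ᵥ θ₀ + ε i ω))
      ((fun a => V l ω a + T l ω a) ⬝ᵥ θ₀ - (V k ω ⬝ᵥ θ₀ + ε k ω)) (V j ω a + T j ω a)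
      (V l ω a + T l ω a)) 2 μ := by
  have m1 := h.measurable_diff θ₀ i j
  have m2 := h.measurable_diff θ₀ k l
  have m3 := h.measurable_obs a j
  have m4 := h.measurable_obs a l
  have hg := (((h.uniformL2_obs a).1 j).norm.add ((h.uniformL2_obs a).1 l).norm).const_mul (2 * L)
  refine hg.of_le (by unfold phaseTerm; fun_prop) (ae_of_all _ fun ω => ?_)
  exact (abs_phaseTerm_le hL _ _ _ _).trans (le_abs_self _)

lemma memLp_phaseGrad (h : ReducedModel μ V T R ε) {σ : ℝ → ℝ} (hσ : Measurable σ) {L : ℝ}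
    (hL : ∀ x, |σ x| ≤ L) (w : ℕ → ℝ) (n : ℕ) (θ₀ : ι → ℝ) (a : ι) :
    MemLp (fun ω => phaseGrad σ w (fun j a => V j ω a + T j ω a) (fun j => V j ω ⬝ᵥ θ₀ + ε j ω)
      n θ₀ a) 2 μ :=
  memLp_finsetSum _ fun i _ => memLp_finsetSum _ fun j _ => memLp_finsetSum _ fun k _ =>
    memLp_finsetSum _ fun l _ => (h.memLp_phaseTerm hσ hL θ₀ a i j k l).const_mul _

variable [IsProbabilityMeasure μ]

/-- The difference between the linear predictor of observation `j` and the outcome of observation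
`i` is symmetric, although the covariates need not be: for `i ≠ j` it contains the difference of
two independent copies of `V ⬝ᵥ θ₀`, and for `i = j` these terms cancel. -/
lemma symm_diff (h : ReducedModel μ V T R ε) (θ₀ : ι → ℝ) (i j : ℕ) :
    IdentDistrib (fun ω => (fun a => V j ω a + T j ω a) ⬝ᵥ θ₀ - (V i ω ⬝ᵥ θ₀ + ε i ω))
      (fun ω => -((fun a => V j ω a + T j ω a) ⬝ᵥ θ₀ - (V i ω ⬝ᵥ θ₀ + ε i ω))) μ μ := by
  have hlin : Measurable fun x : ι → ℝ => x ⬝ᵥ θ₀ := by simp only [dotProduct]; fun_prop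
  have hsplit : ∀ ω, (fun a => V j ω a + T j ω a) ⬝ᵥ θ₀ = V j ω ⬝ᵥ θ₀ + T j ω ⬝ᵥ θ₀ :=
    fun ω => add_dotProduct _ _ _
  have hsT : IdentDistrib (fun ω => T j ω ⬝ᵥ θ₀) (fun ω => -(T j ω ⬝ᵥ θ₀)) μ μ := by
    convert (h.symm_T j).comp hlin using 1
    · rfl
    · ext ω
      simp
  simp only [hsplit]
  by_cases hij : i = j
  · subst hij
    convert identDistrib_sub_neg_of_symm (x := fun ω => T i ω ⬝ᵥ θ₀) (y := ε i)
      ((h.indep_error i).comp (φ := fun x : (ι → ℝ) × (ι → ι → ℝ) => x.1 ⬝ᵥ θ₀)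
        (ψ := fun x : (ι → ℝ) × ℝ => x.2) (hlin.comp measurable_fst) measurable_snd)
      hsT (h.symm_ε i) using 2 <;> ring
  · refine identDistrib_sub_neg_of_add (v := fun ω => V j ω ⬝ᵥ θ₀) (t := fun ω => T j ω ⬝ᵥ θ₀)
      (v' := fun ω => V i ω ⬝ᵥ θ₀) (e := ε i) (hlin.comp (h.measurable_V j))
      (hlin.comp (h.measurable_T j)) (hlin.comp (h.measurable_V i)) (h.measurable_ε i)
      ?_ ?_ ?_ hsT (h.symm_ε i) ?_
    · exact ((h.indep_error j).comp (φ := fun x : (ι → ℝ) × (ι → ι → ℝ) => x.1 ⬝ᵥ θ₀)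
        (ψ := fun x : (ι → ℝ) × ℝ => x.1 ⬝ᵥ θ₀) (hlin.comp measurable_fst)
        (hlin.comp measurable_fst)).symm
    · exact (h.indep_V_ε i).comp (φ := fun x : ι → ℝ => x ⬝ᵥ θ₀) (ψ := fun x : ℝ => x) hlin
        measurable_id
    · exact ((h.identDistrib j).trans (h.identDistrib i).symm).comp
        (u := fun x : (ι → ℝ) × ℝ => x.1 ⬝ᵥ θ₀) (hlin.comp measurable_fst)
    · exact (h.indep.indepFun (Ne.symm hij)).comp
        (φ := fun x : (ι → ℝ) × (ι → ℝ) × (ι → ι → ℝ) × ℝ => x.1 ⬝ᵥ θ₀ + x.2.1 ⬝ᵥ θ₀)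
        (ψ := fun x : (ι → ℝ) × (ι → ℝ) × (ι → ι → ℝ) × ℝ => x.1 ⬝ᵥ θ₀ + x.2.2.2)
        (by simp only [dotProduct]; fun_prop) (by simp only [dotProduct]; fun_prop)

/-- The phase function score has bias `O(1 / n)` at the true parameter, since only pairs of pairs
with a common observation contribute to its mean. -/
lemma exists_abs_integral_phaseGrad_le (h : ReducedModel μ V T R ε) {σ : ℝ → ℝ}
    (hσ : Measurable σ) {L : ℝ} (hL : ∀ x, |σ x| ≤ L) (hodd : ∀ x, σ (-x) = -σ x)
    {w : ℕ → ℕ → ℝ} (hw0 : ∀ n, ∀ j < n, 0 ≤ w n j)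
    (hw1 : ∀ n, 1 ≤ n → ∑ j ∈ Finset.range n, w n j = 1)
    (hwmax : ∃ C : ℝ, ∀ n, ∀ j < n, w n j ≤ C / n) (θ₀ : ι → ℝ) (a : ι) :
    ∃ D, 0 ≤ D ∧ ∀ n : ℕ, 1 ≤ n → |∫ ω, phaseGrad σ (w n) (fun j a => V j ω a + T j ω a)
      (fun j => V j ω ⬝ᵥ θ₀ + ε j ω) n θ₀ a ∂μ| ≤ D / n := by
  obtain ⟨C, hC⟩ := hwmax
  obtain ⟨B, hB0, hB⟩ := (h.uniformL2_obs a).exists_integral_abs_le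
  have hL0 : 0 ≤ L := (abs_nonneg _).trans (hL 0)
  have hC0 : 0 ≤ C := by
    have h1 := (hw0 1 0 (by norm_num)).trans (hC 1 0 (by norm_num))
    simpa using h1
  refine ⟨4 * L * B * ((3 + C) / 2), by positivity, fun n hn => ?_⟩
  have hint := fun i j k l => (h.memLp_phaseTerm hσ hL θ₀ a i j k l).integrable (by norm_num)
  -- every term is at most `4 L B`, and zero if the four indices are separated
  have hterm : ∀ i j k l : ℕ, |∫ ω, phaseTerm σ
      ((fun a => V j ω a + T j ω a) ⬝ᵥ θ₀ - (V i ω ⬝ᵥ θ₀ + ε i ω))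
      ((fun a => V l ω a + T l ω a) ⬝ᵥ θ₀ - (V k ω ⬝ᵥ θ₀ + ε k ω)) (V j ω a + T j ω a)
      (V l ω a + T l ω a) ∂μ| ≤ 4 * L * B * ((if i = k then 1 else 0) + (if i = l then 1 else 0)
        + (if j = k then 1 else 0) + (if j = l then 1 else 0)) := by
    intro i j k l
    have hj := ((h.uniformL2_obs a).1 j).integrable (q := 2) (by norm_num)
    have hl := ((h.uniformL2_obs a).1 l).integrable (q := 2) (by norm_num)
    by_cases hsep : i ≠ k ∧ i ≠ l ∧ j ≠ k ∧ j ≠ l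
    · obtain ⟨hik, hil, hjk, hjl⟩ := hsep
      rw [integral_phaseTerm_eq_zero hσ hL hodd (h.measurable_diff θ₀ i j)
        (h.measurable_diff θ₀ k l) (h.measurable_obs a j) (h.measurable_obs a l) hj hl
        (h.indepFun_diff θ₀ a hik hil hjk hjl) (h.symm_diff θ₀ i j) (h.symm_diff θ₀ k l)]
      simp [hik, hil, hjk, hjl]
    · have hone : (1 : ℝ) ≤ (if i = k then 1 else 0) + (if i = l then 1 else 0)
          + (if j = k then 1 else 0) + (if j = l then 1 else 0) := by
        split_ifs <;> first | (exfalso; tauto) | norm_num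
      refine le_trans ?_ (le_mul_of_one_le_right (by positivity) hone)
      calc _ ≤ ∫ ω, 2 * L * (|V j ω a + T j ω a| + |V l ω a + T l ω a|) ∂μ :=
            (abs_integral_le_integral_abs).trans (integral_mono (hint i j k l).abs
              ((hj.abs.add hl.abs).const_mul _) fun ω => abs_phaseTerm_le hL _ _ _ _)
        _ = 2 * L * (∫ ω, |V j ω a + T j ω a| ∂μ + ∫ ω, |V l ω a + T l ω a| ∂μ) := by
            rw [integral_const_mul, integral_add hj.abs hl.abs]
        _ ≤ 2 * L * (B + B) := by gcongr <;> exact hB _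
        _ = 4 * L * B := by ring
  have hintw := fun i j k l => (hint i j k l).const_mul ((n : ℝ)⁻¹ ^ 2 * w n j * w n l / 2)
  simp only [phaseGrad]
  rw [integral_finsetSum _ fun i _ => integrable_finsetSum _ fun j _ => integrable_finsetSum _
    fun k _ => integrable_finsetSum _ fun l _ => hintw i j k l]
  have hexp : ∀ i, ∫ ω, ∑ j ∈ Finset.range n, ∑ k ∈ Finset.range n, ∑ l ∈ Finset.range n,
      ((n : ℝ)⁻¹ ^ 2 * w n j * w n l / 2) * phaseTerm σ
      ((fun a => V j ω a + T j ω a) ⬝ᵥ θ₀ - (V i ω ⬝ᵥ θ₀ + ε i ω))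
      ((fun a => V l ω a + T l ω a) ⬝ᵥ θ₀ - (V k ω ⬝ᵥ θ₀ + ε k ω)) (V j ω a + T j ω a)
      (V l ω a + T l ω a) ∂μ = ∑ j ∈ Finset.range n, ∑ k ∈ Finset.range n, ∑ l ∈ Finset.range n,
      ((n : ℝ)⁻¹ ^ 2 * w n j * w n l / 2) * ∫ ω, phaseTerm σ
      ((fun a => V j ω a + T j ω a) ⬝ᵥ θ₀ - (V i ω ⬝ᵥ θ₀ + ε i ω))
      ((fun a => V l ω a + T l ω a) ⬝ᵥ θ₀ - (V k ω ⬝ᵥ θ₀ + ε k ω)) (V j ω a + T j ω a)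
      (V l ω a + T l ω a) ∂μ := by
    intro i
    rw [integral_finsetSum _ fun j _ => integrable_finsetSum _
      fun k _ => integrable_finsetSum _ fun l _ => hintw i j k l]
    refine Finset.sum_congr rfl fun j _ => ?_
    rw [integral_finsetSum _ fun k _ => integrable_finsetSum _ fun l _ => hintw i j k l]
    refine Finset.sum_congr rfl fun k _ => ?_
    rw [integral_finsetSum _ fun l _ => hintw i j k l]
    exact Finset.sum_congr rfl fun l _ => integral_const_mul _ _
  simp only [hexp]
  calc _ ≤ ∑ i ∈ Finset.range n, ∑ j ∈ Finset.range n, ∑ k ∈ Finset.range n,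
        ∑ l ∈ Finset.range n, 4 * L * B * (((n : ℝ)⁻¹ ^ 2 * w n j * w n l / 2) *
          ((if i = k then 1 else 0) + (if i = l then 1 else 0)
            + (if j = k then 1 else 0) + (if j = l then 1 else 0))) := by
        refine (Finset.abs_sum_le_sum_abs _ _).trans (Finset.sum_le_sum fun i _ => ?_)
        refine (Finset.abs_sum_le_sum_abs _ _).trans (Finset.sum_le_sum fun j hj => ?_)
        refine (Finset.abs_sum_le_sum_abs _ _).trans (Finset.sum_le_sum fun k _ => ?_)
        refine (Finset.abs_sum_le_sum_abs _ _).trans (Finset.sum_le_sum fun l hl => ?_)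
        have h1 := hw0 n j (Finset.mem_range.1 hj)
        have h2 := hw0 n l (Finset.mem_range.1 hl)
        have hc : 0 ≤ (n : ℝ)⁻¹ ^ 2 * w n j * w n l / 2 := by positivity
        rw [abs_mul, abs_of_nonneg hc, mul_left_comm]
        exact mul_le_mul_of_nonneg_left (hterm i j k l) hc
    _ ≤ 4 * L * B * ((3 + C) / (2 * n)) := by
        simp only [← Finset.mul_sum _ _ (4 * L * B)]
        exact mul_le_mul_of_nonneg_left (sum_overlap_le (hw0 n) (hw1 n hn) (hC n)) (by positivity)
    _ = 4 * L * B * ((3 + C) / 2) / n := by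
        rw [div_mul_eq_div_div, mul_div_assoc]

end ReducedModel

end Phase

/-! ### Consistency in the reduced model -/

section Consistency

variable {Ω : Type*} [MeasurableSpace Ω] {μ : Measure Ω} [IsProbabilityMeasure μ]

/-- If `M` is the covariance matrix of `S`, then `Sᵀ M⁻¹ S` has mean `dim S + mᵀ M⁻¹ m`, where `m`
is the mean of `S`. -/
lemma integral_quadForm_covMatrix {κ : Type*} [Fintype κ] [DecidableEq κ] {S : Ω → κ → ℝ}
    (hS : ∀ i, MemLp (fun ω => S ω i) 2 μ) (hM : (covMatrix μ S).PosDef) :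
    Integrable (fun ω => quadForm (covMatrix μ S) (S ω)) μ ∧
      ∫ ω, quadForm (covMatrix μ S) (S ω) ∂μ =
        Fintype.card κ + quadForm (covMatrix μ S) fun i => ∫ ω, S ω i ∂μ := by
  have hint : ∀ a b, Integrable (fun ω => (covMatrix μ S)⁻¹ a b * (S ω a * S ω b)) μ :=
    fun a b => ((hS a).integrable_mul (hS b)).const_mul _
  have hE : ∀ a b, ∫ ω, S ω a * S ω b ∂μ =
      covMatrix μ S a b + (∫ ω, S ω a ∂μ) * ∫ ω, S ω b ∂μ := fun a b => by
    simp only [covMatrix, Matrix.of_apply]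
    rw [covariance_eq_sub (hS a) (hS b)]
    simp
  simp only [quadForm_eq_sum]
  refine ⟨integrable_finsetSum _ fun a _ => integrable_finsetSum _ fun b _ => hint a b, ?_⟩
  rw [integral_finsetSum _ fun a _ => integrable_finsetSum _ fun b _ => hint a b,
    ← sum_inv_mul_eq_card hM, ← Finset.sum_add_distrib]
  refine Finset.sum_congr rfl fun a _ => ?_
  rw [integral_finsetSum _ fun b _ => hint a b, ← Finset.sum_add_distrib]
  refine Finset.sum_congr rfl fun b _ => ?_
  rw [integral_const_mul, hE, mul_add]

/-- If the mean of `S n` is `O(1 / n)` and the covariance matrix of `S n` has an inverse of order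
`o(n³)`, then its quadratic form in `S n` has mean `o(n)`. -/
lemma tendsto_integral_quadForm_div {κ : Type*} [Fintype κ] [DecidableEq κ] {S : ℕ → Ω → κ → ℝ}
    (hS : ∀ n i, MemLp (fun ω => S n ω i) 2 μ)
    (hmean : ∀ i, ∃ D, ∀ n : ℕ, 1 ≤ n → |∫ ω, S n ω i ∂μ| ≤ D / n)
    (hnondeg : ∀ C : ℝ, ∀ᶠ n : ℕ in atTop,
      ((n : ℝ) ^ 3 • covMatrix μ (S n) - C • (1 : Matrix κ κ ℝ)).PosSemidef) :
    Tendsto (fun n : ℕ => (∫ ω, quadForm (covMatrix μ (S n)) (S n ω) ∂μ) / n) atTop (𝓝 0) := by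
  choose D hD using hmean
  set B := ∑ i, D i ^ 2 with hB
  have hB0 : 0 ≤ B := Finset.sum_nonneg fun i _ => sq_nonneg _
  rw [Metric.tendsto_atTop']
  intro δ hδ
  set c := 2 * (B + 1) / δ with hc
  have hc0 : 0 < c := by positivity
  have hlim : Tendsto (fun n : ℕ => (Fintype.card κ : ℝ) / n) atTop (𝓝 0) :=
    tendsto_const_div_atTop_nhds_zero_nat _
  have hev := ((hnondeg c).and (hlim.eventually (gt_mem_nhds (half_pos hδ)))).and
    (eventually_ge_atTop 1)
  obtain ⟨N, hN⟩ := eventually_atTop.1 hev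
  refine ⟨N, fun n hn => ?_⟩
  obtain ⟨⟨h1, h2⟩, h3⟩ := hN n hn.le
  have hn' : (0 : ℝ) < n := by exact_mod_cast h3
  have hpd := posDef_of_posSemidef_smul_sub (by positivity) hc0 h1
  have hm := quadForm_le_of_posSemidef (by positivity) hc0 h1 fun i => ∫ ω, S n ω i ∂μ
  have hmm : (fun i => ∫ ω, S n ω i ∂μ) ⬝ᵥ (fun i => ∫ ω, S n ω i ∂μ) ≤ B / (n : ℝ) ^ 2 := by
    rw [hB, Finset.sum_div, dotProduct]
    refine Finset.sum_le_sum fun i _ => ?_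
    rw [← sq, ← div_pow, ← sq_abs]
    exact pow_le_pow_left₀ (abs_nonneg _) (hD i n h3) 2
  have hQ0 : 0 ≤ ∫ ω, quadForm (covMatrix μ (S n)) (S n ω) ∂μ :=
    integral_nonneg fun ω => quadForm_nonneg hpd _
  have hbound : (∫ ω, quadForm (covMatrix μ (S n)) (S n ω) ∂μ) / n ≤
      Fintype.card κ / n + B / c := by
    rw [(integral_quadForm_covMatrix (hS n) hpd).2, add_div]
    refine add_le_add le_rfl ?_
    rw [div_le_iff₀ hn']
    refine (hm.trans (mul_le_mul_of_nonneg_left hmm (by positivity))).trans (le_of_eq ?_)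
    field_simp
  have hBc : B / c < δ / 2 := by
    rw [hc, div_div_eq_mul_div, div_lt_iff₀ (by positivity)]
    nlinarith
  rw [Real.dist_eq, sub_zero, abs_of_nonneg (by positivity)]
  linarith

namespace ReducedModel

variable {ι : Type*} [Fintype ι] [DecidableEq ι]
  {V T : ℕ → Ω → ι → ℝ} {R : ℕ → Ω → ι → ι → ℝ} {ε : ℕ → Ω → ℝ}

/-- Consistency of the minimizers of `Q`. Compared with the true parameter, a minimizer satisfies
`Q ≤ Q(θ₀) = o(n)` in probability, and as `Q` controls the square of every component of the
moment-corrected score up to its variance `O(1 / n)`, that score vanishes asymptotically at the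
minimizer. It is affine in `θ` with a slope that tends to twice the second moment matrix of the true
covariates, and this identifies the parameter. -/
theorem tendstoInMeasure_minimizer (h : ReducedModel μ V T R ε)
    (hM : (Matrix.of fun a b => ∫ ω, V 0 ω a * V 0 ω b ∂μ).PosDef)
    {σ : ℝ → ℝ} (hσ : Measurable σ) {L : ℝ} (hL : ∀ x, |σ x| ≤ L) (hodd : ∀ x, σ (-x) = -σ x)
    {w : ℕ → ℕ → ℝ} (hw0 : ∀ n, ∀ j < n, 0 ≤ w n j)
    (hw1 : ∀ n, 1 ≤ n → ∑ j ∈ Finset.range n, w n j = 1)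
    (hwmax : ∃ C : ℝ, ∀ n, ∀ j < n, w n j ≤ C / n) {Θ : Set (ι → ℝ)} (hΘ : IsCompact Θ)
    {θ₀ : ι → ℝ} (hθ₀ : θ₀ ∈ Θ) {S : ℕ → Ω → (ι → ℝ) → ι ⊕ ι → ℝ}
    (hS : ∀ n ω θ, S n ω θ = Sum.elim
      (linScore (fun j => corrGram (V j ω) (T j ω) (R j ω)) (fun j a => V j ω a + T j ω a)
        (fun j => V j ω ⬝ᵥ θ₀ + ε j ω) n θ)
      (phaseGrad σ (w n) (fun j a => V j ω a + T j ω a) (fun j => V j ω ⬝ᵥ θ₀ + ε j ω) n θ))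
    (hnondeg : ∀ C : ℝ, ∀ᶠ n : ℕ in atTop,
      ((n : ℝ) ^ 3 • covMatrix μ (fun ω => S n ω θ₀) - C • 1).PosSemidef)
    {θhat : ℕ → Ω → ι → ℝ}
    (hmin : ∀ n, ∀ᵐ ω ∂μ, θhat n ω ∈ Θ ∧
      IsMinOn (fun θ => quadForm (covMatrix μ fun ω => S n ω θ₀) (S n ω θ)) Θ (θhat n ω)) :
    TendstoInMeasure μ θhat atTop fun _ => θ₀ := by
  have hSl : ∀ n ω θ a, S n ω θ (Sum.inl a) =
      linScore (fun j => corrGram (V j ω) (T j ω) (R j ω)) (fun j a => V j ω a + T j ω a)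
        (fun j => V j ω ⬝ᵥ θ₀ + ε j ω) n θ a := fun n ω θ a => by rw [hS, Sum.elim_inl]
  have hSr : ∀ n ω θ a, S n ω θ (Sum.inr a) =
      phaseGrad σ (w n) (fun j a => V j ω a + T j ω a) (fun j => V j ω ⬝ᵥ θ₀ + ε j ω) n θ a :=
    fun n ω θ a => by rw [hS, Sum.elim_inr]
  have hS2 : ∀ n i, MemLp (fun ω => S n ω θ₀ i) 2 μ := by
    rintro n (a | a)
    · simp only [hSl]; exact h.memLp_linScore θ₀ n a
    · simp only [hSr]; exact h.memLp_phaseGrad hσ hL (w n) n θ₀ a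
  have hmean : ∀ i, ∃ D, ∀ n : ℕ, 1 ≤ n → |∫ ω, S n ω θ₀ i ∂μ| ≤ D / n := by
    rintro (a | a)
    · simp only [hSl, h.integral_linScore θ₀]
      exact ⟨0, fun n _ => by simp⟩
    · simp only [hSr]
      obtain ⟨D, -, hD⟩ := h.exists_abs_integral_phaseGrad_le hσ hL hodd hw0 hw1 hwmax θ₀ a
      exact ⟨D, hD⟩
  have hEQ := tendsto_integral_quadForm_div hS2 hmean hnondeg
  have hpd : ∀ᶠ n : ℕ in atTop, (covMatrix μ fun ω => S n ω θ₀).PosDef := by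
    filter_upwards [hnondeg 1, eventually_ge_atTop 1] with n hn hn1
    have : (0 : ℝ) < n := by exact_mod_cast hn1
    exact posDef_of_posSemidef_smul_sub (by positivity) one_pos hn
  choose C hC0 hC using h.exists_variance_linScore_le θ₀
  -- the moment-corrected score at the minimizer is small
  have hsqrt : ∀ a, TendstoInMeasure μ (fun (n : ℕ) ω =>
      √(C a / n * quadForm (covMatrix μ fun ω => S n ω θ₀) (S n ω θ₀))) atTop fun _ => 0 := by
    intro a
    refine tendstoInMeasure_sqrt_of_tendsto_integral ?_ ?_ ?_
    · filter_upwards [hpd] with n hn ω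
      have := quadForm_nonneg hn (S n ω θ₀)
      have := hC0 a
      positivity
    · filter_upwards [hpd] with n hn
      exact (integral_quadForm_covMatrix (hS2 n) hn).1.const_mul _
    · have := hEQ.const_mul (C a)
      rw [mul_zero] at this
      refine this.congr fun n => ?_
      rw [integral_const_mul]
      ring
  have hlin : ∀ᶠ n : ℕ in atTop, ∀ᵐ ω ∂μ, ∀ a, |S n ω (θhat n ω) (Sum.inl a)| ≤
      √(C a / n * quadForm (covMatrix μ fun ω => S n ω θ₀) (S n ω θ₀)) := by
    filter_upwards [hpd] with n hn
    filter_upwards [hmin n] with ω hω a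
    refine Real.abs_le_sqrt ?_
    refine (sq_apply_le_mul_quadForm hn _ (Sum.inl a)).trans ?_
    have hvar : covMatrix μ (fun ω => S n ω θ₀) (Sum.inl a) (Sum.inl a) ≤ C a / n := by
      simp only [covMatrix, Matrix.of_apply]
      rw [covariance_self (hS2 n _).aestronglyMeasurable.aemeasurable]
      simp only [hSl]
      exact hC a n
    have := hC0 a
    exact mul_le_mul hvar (hω.2 hθ₀) (quadForm_nonneg hn _) (by positivity)
  obtain ⟨r, hr⟩ : ∃ r : ℝ, ∀ θ ∈ Θ, ‖θ - θ₀‖ ≤ r := by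
    obtain ⟨r, hr⟩ := hΘ.isBounded.subset_closedBall θ₀
    exact ⟨r, fun θ hθ => by simpa [dist_eq_norm] using hr hθ⟩
  have hr0 : 0 ≤ r := (norm_nonneg _).trans (hr θ₀ hθ₀)
  set M : Matrix ι ι ℝ := Matrix.of fun a b => ∫ ω, V 0 ω a * V 0 ω b ∂μ with hMdef
  set Hbar : ℕ → Ω → ι → ι → ℝ := fun n ω a b =>
    (n : ℝ)⁻¹ * ∑ j ∈ Finset.range n, corrGram (V j ω) (T j ω) (R j ω) a b with hHbar
  set κ : ℝ := ∑ a, ∑ b, |M⁻¹ a b| with hκ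
  have hκ0 : 0 ≤ κ := Finset.sum_nonneg fun a _ => Finset.sum_nonneg fun b _ => abs_nonneg _
  have hκle : ∀ a b, |M⁻¹ a b| ≤ κ := fun a b =>
    (Finset.single_le_sum (f := fun b => |M⁻¹ a b|) (fun b _ => abs_nonneg _)
      (Finset.mem_univ b)).trans
      (Finset.single_le_sum (f := fun a => ∑ b, |M⁻¹ a b|)
        (fun a _ => Finset.sum_nonneg fun b _ => abs_nonneg _) (Finset.mem_univ a))
  have hbnd : TendstoInMeasure μ (fun (n : ℕ) ω => κ * ∑ a, (∑ b, r * |Hbar n ω a b - M a b| +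
      2⁻¹ * (√(C a / n * quadForm (covMatrix μ fun ω => S n ω θ₀) (S n ω θ₀)) +
        |S n ω θ₀ (Sum.inl a)|))) atTop fun _ => 0 := by
    refine tendstoInMeasure_zero_const_mul _ (tendstoInMeasure_zero_sum _ fun a _ =>
      tendstoInMeasure_zero_add (tendstoInMeasure_zero_sum _ fun b _ =>
        tendstoInMeasure_zero_const_mul _ (tendstoInMeasure_zero_abs ?_))
        (tendstoInMeasure_zero_const_mul _ (tendstoInMeasure_zero_add (hsqrt a)
          (tendstoInMeasure_zero_abs ?_))))
    · exact h.tendstoInMeasure_corrGram a b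
    · simp only [hSl]
      exact h.tendstoInMeasure_linScore θ₀ a
  refine tendstoInMeasure_of_norm_sub_le hbnd ?_
  filter_upwards [hlin] with n hn
  filter_upwards [hn, hmin n] with ω hω hωmin
  set d : ι → ℝ := θhat n ω - θ₀ with hd
  have hdr : ∀ b, |d b| ≤ r := fun b =>
    (norm_le_pi_norm d b).trans (hr _ hωmin.1)
  have hMd : ∀ a, |(M *ᵥ d) a| ≤ ∑ b, r * |Hbar n ω a b - M a b| +
      2⁻¹ * (√(C a / n * quadForm (covMatrix μ fun ω => S n ω θ₀) (S n ω θ₀)) +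
        |S n ω θ₀ (Sum.inl a)|) := by
    intro a
    have haff := linScore_sub (fun j => corrGram (V j ω) (T j ω) (R j ω))
      (fun j a => V j ω a + T j ω a) (fun j => V j ω ⬝ᵥ θ₀ + ε j ω) n (θhat n ω) θ₀ a
    rw [← hSl, ← hSl] at haff
    have hsum : (M *ᵥ d) a = -∑ b, (Hbar n ω a b - M a b) * d b +
        2⁻¹ * (S n ω (θhat n ω) (Sum.inl a) - S n ω θ₀ (Sum.inl a)) := by
      rw [haff]
      simp only [Matrix.mulVec, dotProduct, sub_mul, Finset.sum_sub_distrib, hd, Pi.sub_apply,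
        hHbar]
      ring
    rw [hsum]
    refine (abs_add_le _ _).trans (add_le_add ?_ ?_)
    · rw [abs_neg]
      refine (Finset.abs_sum_le_sum_abs _ _).trans (Finset.sum_le_sum fun b _ => ?_)
      rw [abs_mul, mul_comm]
      exact mul_le_mul_of_nonneg_right (hdr b) (abs_nonneg _)
    · rw [abs_mul, abs_of_nonneg (by norm_num : (0 : ℝ) ≤ 2⁻¹)]
      refine mul_le_mul_of_nonneg_left ?_ (by norm_num)
      exact (abs_sub _ _).trans (add_le_add (hω a) le_rfl)
  have hinv : M⁻¹ *ᵥ (M *ᵥ d) = d := by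
    rw [Matrix.mulVec_mulVec,
      Matrix.nonsing_inv_mul _ ((Matrix.isUnit_iff_isUnit_det _).1 hM.isUnit), Matrix.one_mulVec]
  refine (pi_norm_le_iff_of_nonneg ?_).2 fun a => ?_
  · exact mul_nonneg hκ0 (Finset.sum_nonneg fun a _ => (abs_nonneg _).trans (hMd a))
  · rw [Real.norm_eq_abs]
    rw [← hinv, Finset.mul_sum]
    change |∑ b, M⁻¹ a b * (M *ᵥ d) b| ≤ _
    refine (Finset.abs_sum_le_sum_abs _ _).trans (Finset.sum_le_sum fun b _ => ?_)
    rw [abs_mul]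
    exact mul_le_mul (hκle a b) (hMd b) (abs_nonneg _) hκ0

end ReducedModel

end Consistency

/-! ### The scores as explicit sums -/

section Kernel

/-- The transform `x ↦ ∫ t sin (t x) K(t) dt` of the kernel over `[0, tstar]`. -/
noncomputable def kernelSin (K : ℝ → ℝ) (tstar x : ℝ) : ℝ :=
  ∫ t in (0 : ℝ)..tstar, t * Real.sin (t * x) * K t

/-- The cosine transform `x ↦ ∫ cos (t x) K(t) dt` of the kernel over `[0, tstar]`. -/
noncomputable def kernelCos (K : ℝ → ℝ) (tstar x : ℝ) : ℝ :=
  ∫ t in (0 : ℝ)..tstar, Real.cos (t * x) * K t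

variable {K : ℝ → ℝ} {tstar : ℝ}

lemma kernelSin_neg (x : ℝ) : kernelSin K tstar (-x) = -kernelSin K tstar x := by
  simp [kernelSin]

lemma abs_kernelSin_le (ht : 0 < tstar) (hK : IntervalIntegrable K volume 0 tstar) (x : ℝ) :
    |kernelSin K tstar x| ≤ ∫ t in (0 : ℝ)..tstar, tstar * |K t| := by
  refine intervalIntegral.norm_integral_le_of_norm_le (E := ℝ) ht.le (ae_of_all _ fun t h => ?_)
    (hK.abs.const_mul tstar)
  rw [Real.norm_eq_abs, abs_mul, abs_mul, abs_of_pos h.1]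
  refine mul_le_mul_of_nonneg_right ?_ (abs_nonneg _)
  calc t * |Real.sin (t * x)| ≤ t * 1 :=
        mul_le_mul_of_nonneg_left (Real.abs_sin_le_one _) h.1.le
    _ ≤ tstar := by rw [mul_one]; exact h.2

lemma continuous_kernelSin (hK : IntervalIntegrable K volume 0 tstar) :
    Continuous (kernelSin K tstar) := by
  refine intervalIntegral.continuous_of_dominated_interval (bound := fun t => |t * K t|)
    (fun x => ?_) (fun x => ae_of_all _ fun t _ => ?_) ?_ (ae_of_all _ fun t _ => by fun_prop)
  · exact (Continuous.aestronglyMeasurable (by fun_prop)).mul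
      hK.def'.aestronglyMeasurable
  · rw [Real.norm_eq_abs, mul_right_comm, abs_mul]
    exact mul_le_of_le_one_right (abs_nonneg _) (Real.abs_sin_le_one _)
  · exact (hK.continuousOn_mul (g := fun t : ℝ => t) continuousOn_id).abs

lemma hasDerivAt_kernelCos (hK : IntervalIntegrable K volume 0 tstar) (x : ℝ) :
    HasDerivAt (kernelCos K tstar) (-kernelSin K tstar x) x := by
  have hmeas : ∀ f : ℝ → ℝ, Continuous f →
      AEStronglyMeasurable (fun t => f t * K t) (volume.restrict (Set.uIoc 0 tstar)) :=
    fun f hf => hf.aestronglyMeasurable.mul hK.def'.aestronglyMeasurable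
  have key := intervalIntegral.hasDerivAt_integral_of_dominated_loc_of_deriv_le
    (F := fun x t => Real.cos (t * x) * K t) (F' := fun x t => -(t * Real.sin (t * x)) * K t)
    (x₀ := x) (a := 0) (b := tstar) (μ := volume) (bound := fun t => |t * K t|) Filter.univ_mem
    (.of_forall fun x => hmeas _ (by fun_prop)) (hK.continuousOn_mul (by fun_prop))
    (hmeas (fun t => -(t * Real.sin (t * x))) (by fun_prop)) (ae_of_all _ fun t _ x _ => ?_)
    (hK.continuousOn_mul (g := fun t : ℝ => t) continuousOn_id).abs
    (ae_of_all _ fun t _ x _ => ?_)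
  · refine key.2.congr_deriv ?_
    simp [kernelSin]
  · rw [Real.norm_eq_abs, neg_mul, abs_neg, mul_right_comm, abs_mul]
    exact mul_le_of_le_one_right (abs_nonneg _) (Real.abs_sin_le_one _)
  · refine ((((hasDerivAt_id x).const_mul t).cos).mul_const (K t)).congr_deriv ?_
    simp only [id, mul_one]
    ring

lemma integral_sin_mul_sin (hK : IntervalIntegrable K volume 0 tstar) (x x' : ℝ) :
    ∫ t in (0 : ℝ)..tstar, Real.sin (t * x) * Real.sin (t * x') * K t =
      2⁻¹ * (kernelCos K tstar (x - x') - kernelCos K tstar (x + x')) := by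
  have hint : ∀ x : ℝ, IntervalIntegrable (fun t => Real.cos (t * x) * K t) volume 0 tstar :=
    fun x => hK.continuousOn_mul (by fun_prop)
  rw [kernelCos, kernelCos, ← intervalIntegral.integral_sub (hint _) (hint _),
    ← intervalIntegral.integral_const_mul]
  congr 1
  ext t
  rw [mul_sub t, mul_add t, Real.cos_sub, Real.cos_add]
  ring

end Kernel

lemma intervalIntegrable_sum {κ : Type*} (s : Finset κ) {f : κ → ℝ → ℝ} {a b : ℝ}
    (h : ∀ i, IntervalIntegrable (f i) volume a b) :
    IntervalIntegrable (fun t => ∑ i ∈ s, f i t) volume a b := by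
  have := IntervalIntegrable.sum s fun i _ => h i
  rwa [Finset.sum_fn] at this

section Scores

variable {p q : ℕ} (D : Data p q)

/-- The observed covariates `(W_j, 1, Z̃_j)`, with averaged replicates. -/
noncomputable def Data.covariates (j : ℕ) : Idx p q → ℝ := Sum.elim (D.Wbar j) (D.Z1 j)

/-- The matrix of squares of the observed covariates, corrected for the measurement errors. -/
noncomputable def Data.corrSquares (j : ℕ) (a b : Idx p q) : ℝ :=
  D.covariates j a * D.covariates j b -
    Matrix.fromBlocks ((D.r j : ℝ)⁻¹ • D.SigmaHat j) 0 0 0 a b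

lemma Data.lin_eq (θ : Param p q) (j : ℕ) : D.lin θ j = D.covariates j ⬝ᵥ θ := by
  simp [Data.lin, Data.covariates, dotProduct, betaOf, gammaOf, Fintype.sum_sum_type]

lemma Data.scoreL_eq (n : ℕ) (θ : Param p q) :
    D.scoreL n θ = linScore D.corrSquares D.covariates D.y n θ := by
  have hsum : ∀ j a, ∑ b, D.covariates j a * D.covariates j b * θ b =
      D.lin θ j * D.covariates j a := fun j a => by
    rw [D.lin_eq, dotProduct, Finset.sum_mul]
    exact Finset.sum_congr rfl fun b _ => by ring
  funext a
  simp only [linScore, Data.corrSquares, sub_mul, Finset.sum_sub_distrib, hsum]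
  rcases a with a | b
  · simp only [Data.scoreL, Data.scoreLbeta, Data.covariates, Sum.elim_inl, Fintype.sum_sum_type,
      Matrix.fromBlocks_apply₁₁, Matrix.fromBlocks_apply₁₂, Pi.sub_apply, Pi.neg_apply,
      Pi.smul_apply, Finset.sum_apply, smul_eq_mul, Matrix.smul_apply, Matrix.mulVec, dotProduct,
      Matrix.zero_apply, zero_mul, Finset.sum_const_zero, add_zero, sub_mul,
      Finset.sum_sub_distrib, betaOf, mul_assoc, ← Finset.mul_sum]
    ring
  · simp only [Data.scoreL, Data.scoreLgamma, Data.covariates, Sum.elim_inr, Fintype.sum_sum_type,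
      Matrix.fromBlocks_apply₂₁, Matrix.fromBlocks_apply₂₂, Pi.neg_apply,
      Pi.smul_apply, Finset.sum_apply, smul_eq_mul,
      Matrix.zero_apply, zero_mul, Finset.sum_const_zero, add_zero, sub_mul,
      Finset.sum_sub_distrib]
    ring

variable {K : ℝ → ℝ} {tstar : ℝ}

/-- The discrepancy compares the phases of the outcomes and the linear predictors through the sines
of their differences. -/
lemma Data.phaseDisc_eq (hK : IntervalIntegrable K volume 0 tstar) (w : ℕ → ℝ) (n : ℕ)
    (θ : Param p q) :
    D.phaseDisc w K tstar n θ = ∑ i ∈ Finset.range n, ∑ j ∈ Finset.range n,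
      ∑ k ∈ Finset.range n, ∑ l ∈ Finset.range n, ((n : ℝ)⁻¹ ^ 2 * w j * w l / 2) *
        (kernelCos K tstar ((D.covariates j ⬝ᵥ θ - D.y i) - (D.covariates l ⬝ᵥ θ - D.y k)) -
          kernelCos K tstar
            ((D.covariates j ⬝ᵥ θ - D.y i) + (D.covariates l ⬝ᵥ θ - D.y k))) := by
  have hgap : ∀ t, D.Cy n t * (∑ j ∈ Finset.range n, w j * Real.sin (t * D.lin θ j))
      - D.Sy n t * (∑ j ∈ Finset.range n, w j * Real.cos (t * D.lin θ j)) =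
      ∑ i ∈ Finset.range n, ∑ j ∈ Finset.range n,
        (n : ℝ)⁻¹ * w j * Real.sin (t * (D.covariates j ⬝ᵥ θ - D.y i)) := by
    intro t
    simp only [Data.Cy, Data.Sy, mul_assoc, Finset.sum_mul_sum, ← mul_sub,
      ← Finset.sum_sub_distrib]
    rw [Finset.mul_sum]
    refine Finset.sum_congr rfl fun i _ => ?_
    rw [Finset.mul_sum]
    refine Finset.sum_congr rfl fun j _ => ?_
    rw [mul_sub t, Real.sin_sub, D.lin_eq]
    ring
  have hint : ∀ (c x x' : ℝ), IntervalIntegrable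
      (fun t => c * (Real.sin (t * x) * Real.sin (t * x') * K t)) volume 0 tstar := fun c x x' =>
    (hK.continuousOn_mul (by fun_prop)).const_mul c
  have hexp : ∀ t, (D.Cy n t * (∑ j ∈ Finset.range n, w j * Real.sin (t * D.lin θ j))
      - D.Sy n t * (∑ j ∈ Finset.range n, w j * Real.cos (t * D.lin θ j))) ^ 2 * K t =
      ∑ i ∈ Finset.range n, ∑ j ∈ Finset.range n, ∑ k ∈ Finset.range n, ∑ l ∈ Finset.range n,
        ((n : ℝ)⁻¹ ^ 2 * w j * w l) * (Real.sin (t * (D.covariates j ⬝ᵥ θ - D.y i)) *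
          Real.sin (t * (D.covariates l ⬝ᵥ θ - D.y k)) * K t) := by
    intro t
    rw [hgap, sq, Finset.sum_mul, Finset.sum_mul]
    refine Finset.sum_congr rfl fun i _ => ?_
    rw [Finset.sum_mul, Finset.sum_mul]
    refine Finset.sum_congr rfl fun j _ => ?_
    rw [Finset.mul_sum, Finset.sum_mul]
    refine Finset.sum_congr rfl fun k _ => ?_
    rw [Finset.mul_sum, Finset.sum_mul]
    refine Finset.sum_congr rfl fun l _ => ?_
    ring
  simp only [Data.phaseDisc, hexp]
  rw [intervalIntegral.integral_finsetSum fun i _ => intervalIntegrable_sum _ fun j =>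
    intervalIntegrable_sum _ fun k => intervalIntegrable_sum _ fun l => hint _ _ _]
  refine Finset.sum_congr rfl fun i _ => ?_
  rw [intervalIntegral.integral_finsetSum fun j _ => intervalIntegrable_sum _ fun k =>
    intervalIntegrable_sum _ fun l => hint _ _ _]
  refine Finset.sum_congr rfl fun j _ => ?_
  rw [intervalIntegral.integral_finsetSum fun k _ => intervalIntegrable_sum _ fun l => hint _ _ _]
  refine Finset.sum_congr rfl fun k _ => ?_
  rw [intervalIntegral.integral_finsetSum fun l _ => hint _ _ _]
  refine Finset.sum_congr rfl fun l _ => ?_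
  rw [intervalIntegral.integral_const_mul, integral_sin_mul_sin hK]
  ring

lemma hasDerivAt_dotProduct_update {κ : Type*} [Fintype κ] [DecidableEq κ] (v θ : κ → ℝ) (a : κ) :
    HasDerivAt (fun s => v ⬝ᵥ Function.update θ a s) (v a) (θ a) := by
  have h : ∀ s, v ⬝ᵥ Function.update θ a s = v ⬝ᵥ θ + v a * (s - θ a) := fun s => by
    rw [show Function.update θ a s = θ + Pi.single a (s - θ a) by
      ext b
      rcases eq_or_ne b a with rfl | hb
      · simp
      · simp [hb], dotProduct_add, dotProduct_single]
  simp only [h]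
  simpa using (((hasDerivAt_id (θ a)).sub_const (θ a)).const_mul (v a)).const_add (v ⬝ᵥ θ)

lemma Data.scoreD_eq (hK : IntervalIntegrable K volume 0 tstar) (w : ℕ → ℝ) (n : ℕ)
    (θ : Param p q) :
    D.scoreD w K tstar n θ = phaseGrad (kernelSin K tstar) w D.covariates D.y n θ := by
  funext a
  refine HasDerivAt.deriv ?_
  simp only [D.phaseDisc_eq hK, phaseGrad]
  refine HasDerivAt.fun_sum fun i _ => HasDerivAt.fun_sum fun j _ => HasDerivAt.fun_sum fun k _ =>
    HasDerivAt.fun_sum fun l _ => HasDerivAt.const_mul _ ?_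
  have hj := (hasDerivAt_dotProduct_update (D.covariates j) θ a).sub_const (D.y i)
  have hl := (hasDerivAt_dotProduct_update (D.covariates l) θ a).sub_const (D.y k)
  have h1 := (hasDerivAt_kernelCos hK _).comp (θ a) (hj.sub hl)
  have h2 := (hasDerivAt_kernelCos hK _).comp (θ a) (hj.add hl)
  refine (h1.sub h2).congr_deriv ?_
  simp only [phaseTerm, Function.update_eq_self, Pi.sub_apply, Pi.add_apply]
  ring

lemma continuous_linScore {ι : Type*} [Fintype ι] (H : ℕ → ι → ι → ℝ) (A : ℕ → ι → ℝ) (y : ℕ → ℝ)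
    (n : ℕ) (a : ι) : Continuous fun θ => linScore H A y n θ a := by
  simp only [linScore]
  fun_prop

lemma Data.continuous_score (hK : IntervalIntegrable K volume 0 tstar) (w : ℕ → ℝ) (n : ℕ) :
    Continuous fun θ => D.score w K tstar n θ := by
  refine continuous_pi fun i => ?_
  rcases i with a | a
  · simp only [Data.score, Sum.elim_inl, D.scoreL_eq]
    exact continuous_linScore _ _ _ _ _
  · simp only [Data.score, Sum.elim_inr, D.scoreD_eq hK]
    exact continuous_phaseGrad (continuous_kernelSin hK) _ _ _ _ _

end Scores

/-! ### Replicated measurements -/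

section Replicates

variable {p : ℕ} {r : ℕ}

/-- The off-diagonal part of the products of the replicate errors, averaged over the pairs of
distinct replicates. -/
noncomputable def offDiagMean (u : Fin r → Fin p → ℝ) (a b : Fin p) : ℝ :=
  ((Finset.univ : Finset (Fin r)).offDiag.card : ℝ)⁻¹ *
    ∑ x ∈ (Finset.univ : Finset (Fin r)).offDiag, u x.1 a * u x.2 b

/-- The mean of the replicate errors, padded by zeros at the error-free covariates. -/
noncomputable def paddedMean (q : ℕ) (u : Fin r → Fin p → ℝ) : Idx p q → ℝ :=
  Sum.elim (fun a => ((Finset.univ : Finset (Fin r)).card : ℝ)⁻¹ * ∑ k, u k a) 0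

/-- The averaged products of distinct replicate errors, padded by zeros at the error-free
covariates. -/
noncomputable def paddedOffDiagMean (q : ℕ) (u : Fin r → Fin p → ℝ) (a b : Idx p q) : ℝ :=
  Matrix.fromBlocks (Matrix.of (offDiagMean u)) 0 0 0 a b

lemma two_mul_sum_Ioi {f : Fin r → Fin r → ℝ} (hsymm : ∀ k k', f k k' = f k' k)
    (hdiag : ∀ k, f k k = 0) :
    2 * ∑ k, ∑ k' ∈ Finset.Ioi k, f k k' = ∑ k, ∑ k', f k k' := by
  have h1 : ∀ k, ∑ k' ∈ Finset.Ioi k, f k k' = ∑ k', if k < k' then f k k' else 0 := fun k => by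
    rw [← Finset.sum_filter]
    congr 1
    ext k'
    simp
  have h2 : ∑ k, ∑ k', (if k < k' then f k k' else 0) =
      ∑ k, ∑ k', if k' < k then f k k' else 0 := by
    rw [Finset.sum_comm]
    exact Finset.sum_congr rfl fun k _ => Finset.sum_congr rfl fun k' _ => by rw [hsymm]
  simp only [h1]
  rw [two_mul]
  nth_rewrite 2 [h2]
  rw [← Finset.sum_add_distrib]
  refine Finset.sum_congr rfl fun k _ => ?_
  rw [← Finset.sum_add_distrib]
  refine Finset.sum_congr rfl fun k' _ => ?_
  rcases lt_trichotomy k k' with h | rfl | h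
  · simp [h, h.not_gt]
  · simp [hdiag]
  · simp [h, h.not_gt]

lemma sum_Ioi_sub_mul_sub (s t : Fin r → ℝ) :
    ∑ k, ∑ k' ∈ Finset.Ioi k, (s k - s k') * (t k - t k') =
      r * ∑ k, s k * t k - (∑ k, s k) * ∑ k, t k := by
  have h := two_mul_sum_Ioi (f := fun k k' => (s k - s k') * (t k - t k')) (fun k k' => by ring)
    (fun k => by ring)
  have h2 : ∑ k, ∑ k', (s k - s k') * (t k - t k') =
      2 * (r * ∑ k, s k * t k - (∑ k, s k) * ∑ k, t k) := by
    have h3 : ∀ k k', (s k - s k') * (t k - t k') =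
        s k * t k - s k * t k' - (t k * s k' - s k' * t k') := fun k k' => by ring
    simp only [h3, Finset.sum_sub_distrib, ← Finset.mul_sum, ← Finset.sum_mul,
      Finset.sum_const, Finset.card_univ, Fintype.card_fin, nsmul_eq_mul]
    simp only [mul_left_comm _ (r : ℝ), ← Finset.mul_sum]
    ring
  linarith

lemma offDiagMean_eq (u : Fin r → Fin p → ℝ) (a b : Fin p) :
    offDiagMean u a b =
      ((r : ℝ) * (r - 1))⁻¹ * ((∑ k, u k a) * (∑ k, u k b) - ∑ k, u k a * u k b) := by
  have hcard : ((Finset.univ : Finset (Fin r)).offDiag.card : ℝ) = r * (r - 1) := by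
    rw [Finset.offDiag_card, Finset.card_univ, Fintype.card_fin, Nat.cast_sub (Nat.le_mul_self r)]
    push_cast
    ring
  have hsum := Finset.sum_union (Finset.disjoint_diag_offDiag (Finset.univ : Finset (Fin r)))
    (f := fun x : Fin r × Fin r => u x.1 a * u x.2 b)
  rw [Finset.diag_union_offDiag, Finset.sum_product, Finset.sum_diag] at hsum
  dsimp only at hsum
  rw [← Finset.sum_mul_sum] at hsum
  rw [offDiagMean, hcard, hsum]
  ring

variable {q : ℕ} {Ω : Type*}
  (θ₀ : Param p q) (r : ℕ → ℕ) (X : ℕ → Ω → Fin p → ℝ) (Z : ℕ → Ω → Fin q → ℝ) (ε : ℕ → Ω → ℝ)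
  (U : (j : ℕ) → Fin (r j) → Ω → Fin p → ℝ) (ω : Ω)

lemma modelData_y (j : ℕ) : (modelData θ₀ r X Z ε U ω).y j =
    Sum.elim (X j ω) (withIntercept (Z j ω)) ⬝ᵥ θ₀ + ε j ω := by
  simp [modelData, dotProduct, betaOf, gammaOf, Fintype.sum_sum_type]

variable {r}

lemma modelData_covariates (hr : ∀ j, 2 ≤ r j) (j : ℕ) (a : Idx p q) :
    (modelData θ₀ r X Z ε U ω).covariates j a =
      Sum.elim (X j ω) (withIntercept (Z j ω)) a + paddedMean q (fun k => U j k ω) a := by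
  have hr0 : (r j : ℝ) ≠ 0 := by
    have := hr j
    exact_mod_cast (by omega : r j ≠ 0)
  rcases a with a | a
  · have hW : (modelData θ₀ r X Z ε U ω).covariates j (Sum.inl a) =
        (r j : ℝ)⁻¹ * ∑ k, (X j ω a + U j k ω a) := by
      simp only [Data.covariates, Sum.elim_inl, Data.Wbar, Pi.smul_apply, Finset.sum_apply,
        smul_eq_mul]
      rfl
    rw [hW, paddedMean, Sum.elim_inl, Sum.elim_inl]
    rw [Finset.sum_add_distrib, Finset.sum_const, Finset.card_univ, Fintype.card_fin, nsmul_eq_mul]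
    field_simp
  · simp [Data.covariates, Data.Z1, modelData, paddedMean]

/-- Subtracting the replicate-based estimator of the error covariance from the square of the
averaged errors cancels the squares of the individual errors and leaves a U-statistic in the
replicates. -/
lemma modelData_corrSquares (hr : ∀ j, 2 ≤ r j) (j : ℕ) :
    (modelData θ₀ r X Z ε U ω).corrSquares j =
      corrGram (Sum.elim (X j ω) (withIntercept (Z j ω))) (paddedMean q fun k => U j k ω)
        (paddedOffDiagMean q fun k => U j k ω) := by
  have hr2 : (2 : ℝ) ≤ r j := by exact_mod_cast hr j
  have hr0 : (r j : ℝ) ≠ 0 := by positivity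
  have hr1 : (r j : ℝ) - 1 ≠ 0 := by linarith
  ext a b
  simp only [Data.corrSquares, modelData_covariates θ₀ X Z ε U ω hr, corrGram]
  rcases a with a | a <;> rcases b with b | b
  · have hS : (modelData θ₀ r X Z ε U ω).SigmaHat j a b = ((r j : ℝ) * ((r j : ℝ) - 1))⁻¹ *
        (r j * ∑ k, U j k ω a * U j k ω b - (∑ k, U j k ω a) * ∑ k, U j k ω b) := by
      rw [← sum_Ioi_sub_mul_sub]
      simp [Data.SigmaHat, modelData, Matrix.sum_apply, Matrix.vecMulVec_apply]
      exact Or.inl rfl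
    simp only [Matrix.fromBlocks_apply₁₁, Matrix.smul_apply, smul_eq_mul, Sum.elim_inl, paddedMean,
      paddedOffDiagMean, Matrix.of_apply, offDiagMean_eq, Finset.card_univ, Fintype.card_fin]
    change _ - (r j : ℝ)⁻¹ * (modelData θ₀ r X Z ε U ω).SigmaHat j a b = _
    rw [hS]
    field_simp
    ring
  all_goals simp [paddedMean, paddedOffDiagMean]; try ring

end Replicates

section Reduction

variable {Ω : Type*} [MeasurableSpace Ω] {μ : Measure Ω}

/-- Averages over index sets of arbitrary size inherit a common bound on the second moments. -/
lemma UniformL2.average {κ : ℕ → Type*} {s : ∀ j, Finset (κ j)} {f : ∀ j, κ j → Ω → ℝ} {B : ℝ}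
    (hB0 : 0 ≤ B) (hf : ∀ j, ∀ i ∈ s j, MemLp (f j i) 2 μ)
    (hB : ∀ j, ∀ i ∈ s j, ∫ ω, f j i ω ^ 2 ∂μ ≤ B) :
    UniformL2 μ fun j ω => ((s j).card : ℝ)⁻¹ * ∑ i ∈ s j, f j i ω := by
  have hmem : ∀ j, MemLp (fun ω => ∑ i ∈ s j, f j i ω) 2 μ := fun j =>
    memLp_finsetSum _ (hf j)
  refine ⟨fun j => (hmem j).const_mul _, B, fun j => ?_⟩
  simp only [mul_pow]
  rw [integral_const_mul]
  have h1 : ∫ ω, (∑ i ∈ s j, f j i ω) ^ 2 ∂μ ≤ (s j).card * ((s j).card * B) := by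
    calc ∫ ω, (∑ i ∈ s j, f j i ω) ^ 2 ∂μ
        ≤ ∫ ω, (s j).card * ∑ i ∈ s j, f j i ω ^ 2 ∂μ :=
          integral_mono (hmem j).integrable_sq
            ((integrable_finsetSum _ fun i hi => (hf j i hi).integrable_sq).const_mul _)
            fun ω => sq_sum_le_card_mul_sum_sq
      _ = (s j).card * ∑ i ∈ s j, ∫ ω, f j i ω ^ 2 ∂μ := by
          rw [integral_const_mul, integral_finsetSum _ fun i hi => (hf j i hi).integrable_sq]
      _ ≤ (s j).card * ((s j).card * B) := by
          refine mul_le_mul_of_nonneg_left ?_ (Nat.cast_nonneg _)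
          simpa using Finset.sum_le_sum (hB j)
  rcases (s j).card.eq_zero_or_pos with h0 | h0
  · simpa [h0] using hB0
  · have h0' : (0 : ℝ) < (s j).card := by exact_mod_cast h0
    calc _ ≤ (((s j).card : ℝ)⁻¹) ^ 2 * ((s j).card * ((s j).card * B)) :=
          mul_le_mul_of_nonneg_left h1 (by positivity)
      _ = B := by field_simp

lemma measurable_withIntercept {q : ℕ} : Measurable (withIntercept (q := q)) := by
  refine measurable_pi_iff.2 fun b => ?_
  induction b using Fin.cases with
  | zero => exact measurable_const
  | succ b => exact measurable_pi_apply b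

lemma measurable_paddedMean {p r : ℕ} (q : ℕ) :
    Measurable (paddedMean q : (Fin r → Fin p → ℝ) → Idx p q → ℝ) := by
  refine measurable_pi_iff.2 fun b => ?_
  rcases b with b | b
  · simp only [paddedMean, Sum.elim_inl]
    fun_prop
  · simp only [paddedMean, Sum.elim_inr]
    fun_prop

lemma measurable_paddedOffDiagMean {p r : ℕ} (q : ℕ) :
    Measurable (paddedOffDiagMean q : (Fin r → Fin p → ℝ) → Idx p q → Idx p q → ℝ) := by
  refine measurable_pi_iff.2 fun a => measurable_pi_iff.2 fun b => ?_
  rcases a with a | a <;> rcases b with b | b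
  · simp only [paddedOffDiagMean, Matrix.fromBlocks_apply₁₁, Matrix.of_apply, offDiagMean]
    fun_prop
  all_goals simp [paddedOffDiagMean]

lemma measurable_sumElim_withIntercept {p q : ℕ} :
    Measurable fun x : (Fin p → ℝ) × (Fin q → ℝ) => (Sum.elim x.1 (withIntercept x.2) :
      Idx p q → ℝ) := by
  refine measurable_pi_iff.2 fun b => ?_
  rcases b with b | b
  · simp only [Sum.elim_inl]
    fun_prop
  · exact (measurable_pi_apply b).comp (measurable_withIntercept.comp measurable_snd)

/-- The errors-in-variables model with replicates satisfies the assumptions of the reduced model. -/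
theorem reducedModel [IsProbabilityMeasure μ] {p q : ℕ} {r : ℕ → ℕ}
    {X : ℕ → Ω → Fin p → ℝ} {Z : ℕ → Ω → Fin q → ℝ} {ε : ℕ → Ω → ℝ}
    {U : (j : ℕ) → Fin (r j) → Ω → Fin p → ℝ} {SigmaU : ℕ → Matrix (Fin p) (Fin p) ℝ}
    (hXm : ∀ j, Measurable (X j)) (hZm : ∀ j, Measurable (Z j)) (hεm : ∀ j, Measurable (ε j))
    (hUm : ∀ j k, Measurable (U j k))
    (hX2 : ∀ j, MemLp (X j) 2 μ) (hZ2 : ∀ j, MemLp (Z j) 2 μ) (hε2 : ∀ j, MemLp (ε j) 2 μ)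
    (hU2 : ∀ j k, MemLp (U j k) 2 μ)
    (hε0 : ∀ j, ∫ ω, ε j ω ∂μ = 0) (hU0 : ∀ j k a, ∫ ω, U j k ω a ∂μ = 0)
    (hUcov : ∀ j k a b, cov[fun ω => U j k ω a, fun ω => U j k ω b; μ] = SigmaU j a b)
    (hSigma : ∃ M : ℝ, ∀ j a, SigmaU j a a ≤ M)
    (hind : iIndepFun (fun (j : ℕ) (ω : Ω) => (X j ω, Z j ω, ε j ω, fun k => U j k ω)) μ)
    (hUU : ∀ j, iIndepFun (fun (k : Fin (r j)) (ω : Ω) => U j k ω) μ)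
    (hUXZ : ∀ j, IndepFun (fun ω => fun k => U j k ω) (fun ω => (X j ω, Z j ω, ε j ω)) μ)
    (hXZε : ∀ j, IndepFun (fun ω => (X j ω, Z j ω)) (ε j) μ)
    (hid : ∀ j, IdentDistrib (fun ω => (X j ω, Z j ω, ε j ω))
      (fun ω => (X 0 ω, Z 0 ω, ε 0 ω)) μ μ)
    (hUsym : ∀ j k, IdentDistrib (U j k) (fun ω => -U j k ω) μ μ)
    (hεsym : ∀ j, IdentDistrib (ε j) (fun ω => -ε j ω) μ μ) :
    ReducedModel μ (fun j ω => Sum.elim (X j ω) (withIntercept (Z j ω)))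
      (fun j ω => paddedMean q fun k => U j k ω)
      (fun j ω => paddedOffDiagMean q fun k => U j k ω) ε := by
  have hUvec : ∀ j, Measurable fun ω => fun k => U j k ω := fun j =>
    measurable_pi_iff.2 fun k => hUm j k
  have hVε : Measurable fun x : (Fin p → ℝ) × (Fin q → ℝ) × ℝ =>
      ((Sum.elim x.1 (withIntercept x.2.1) : Idx p q → ℝ), x.2.2) :=
    (measurable_sumElim_withIntercept.comp (measurable_fst.prodMk
      (measurable_fst.comp measurable_snd))).prodMk (measurable_snd.comp measurable_snd)
  have hident : ∀ j, IdentDistrib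
      (fun ω => ((Sum.elim (X j ω) (withIntercept (Z j ω)) : Idx p q → ℝ), ε j ω))
      (fun ω => ((Sum.elim (X 0 ω) (withIntercept (Z 0 ω)) : Idx p q → ℝ), ε 0 ω)) μ μ :=
    fun j => (hid j).comp hVε
  have hUa : ∀ j k a, MemLp (fun ω => U j k ω a) 2 μ := fun j k a => (hU2 j k).eval a
  obtain ⟨M, hM⟩ := hSigma
  have hUsq : ∀ j k a, ∫ ω, U j k ω a ^ 2 ∂μ ≤ max M 0 := fun j k a => by
    have h := hUcov j k a a
    rw [covariance_self (hUa j k a).aestronglyMeasurable.aemeasurable,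
      variance_of_integral_eq_zero (hUa j k a).aestronglyMeasurable.aemeasurable (hU0 j k a)] at h
    rw [h]
    exact (hM j a).trans (le_max_left _ _)
  have hUind : ∀ j k k' a b, k ≠ k' → IndepFun (fun ω => U j k ω a) (fun ω => U j k' ω b) μ :=
    fun j k k' a b hkk => ((hUU j).indepFun hkk).comp (measurable_pi_apply a)
      (measurable_pi_apply b)
  have hzero : CenteredL2 μ fun _ _ => 0 := ⟨UniformL2.zero, fun _ => by simp⟩
  refine
    { measurable_V := fun j => measurable_sumElim_withIntercept.comp ((hXm j).prodMk (hZm j))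
      measurable_T := fun j => (measurable_paddedMean q).comp (hUvec j)
      measurable_R := fun j => (measurable_paddedOffDiagMean q).comp (hUvec j)
      measurable_ε := hεm
      indep := ?_
      indep_error := ?_
      indep_V_ε := ?_
      identDistrib := hident
      symm_T := ?_
      symm_ε := hεsym
      uniformL2_V := ?_
      centeredL2_T := ?_
      centeredL2_R := ?_
      centeredL2_ε := ?_ }
  · refine hind.comp (fun j (x : (Fin p → ℝ) × (Fin q → ℝ) × ℝ × (Fin (r j) → Fin p → ℝ)) =>
      ((Sum.elim x.1 (withIntercept x.2.1) : Idx p q → ℝ), paddedMean q x.2.2.2,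
        paddedOffDiagMean q x.2.2.2, x.2.2.1)) fun j => ?_
    have hU : Measurable fun x : (Fin p → ℝ) × (Fin q → ℝ) × ℝ × (Fin (r j) → Fin p → ℝ) =>
        x.2.2.2 := by fun_prop
    exact (measurable_sumElim_withIntercept.comp (measurable_fst.prodMk
      (measurable_fst.comp measurable_snd))).prodMk (((measurable_paddedMean q).comp hU).prodMk
        (((measurable_paddedOffDiagMean q).comp hU).prodMk (by fun_prop)))
  · intro j
    exact (hUXZ j).comp (φ := fun u => (paddedMean q u, paddedOffDiagMean q u))
      ((measurable_paddedMean q).prodMk (measurable_paddedOffDiagMean q)) hVε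
  · intro j
    exact (hXZε j).comp measurable_sumElim_withIntercept measurable_id
  · intro j
    have hneg : iIndepFun (fun (k : Fin (r j)) (ω : Ω) => -U j k ω) μ :=
      (hUU j).comp (fun _ x => -x) fun _ => measurable_neg
    have h := (IdentDistrib.pi (hUsym j) (hUU j) hneg).comp (measurable_paddedMean q)
    have e : ∀ ω, -paddedMean q (fun k => U j k ω) = paddedMean q (fun k => -U j k ω) := fun ω => by
      ext a
      rcases a with a | a <;> simp [paddedMean]
    simp only [e]
    exact h
  · intro a
    have hmem : ∀ j, MemLp (fun ω => (Sum.elim (X j ω) (withIntercept (Z j ω)) : Idx p q → ℝ) a)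
        2 μ := fun j => by
      rcases a with a | a
      · exact (hX2 j).eval a
      · induction a using Fin.cases with
        | zero => exact memLp_const (1 : ℝ)
        | succ a => exact (hZ2 j).eval a
    refine ⟨hmem, ∫ ω, (Sum.elim (X 0 ω) (withIntercept (Z 0 ω)) : Idx p q → ℝ) a ^ 2 ∂μ,
      fun j => le_of_eq ?_⟩
    have hm : Measurable fun x : (Idx p q → ℝ) × ℝ => x.1 a ^ 2 := by fun_prop
    exact ((hident j).comp hm).integral_eq
  · rintro (a | a)
    · refine ⟨UniformL2.average (s := fun j => (Finset.univ : Finset (Fin (r j))))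
        (le_max_right M 0) (fun j k _ => hUa j k a) fun j k _ => hUsq j k a, fun j => ?_⟩
      simp only [paddedMean, Sum.elim_inl]
      rw [integral_const_mul, integral_finsetSum _ fun k _ => (hUa j k a).integrable (by norm_num),
        Finset.sum_eq_zero fun k _ => hU0 j k a, mul_zero]
    · simpa [paddedMean] using hzero
  · rintro (a | a) (b | b)
    · have hmul : ∀ j, ∀ x ∈ (Finset.univ : Finset (Fin (r j))).offDiag,
          MemLp (fun ω => U j x.1 ω a * U j x.2 ω b) 2 μ ∧
            ∫ ω, (U j x.1 ω a * U j x.2 ω b) ^ 2 ∂μ =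
              (∫ ω, U j x.1 ω a ^ 2 ∂μ) * ∫ ω, U j x.2 ω b ^ 2 ∂μ := fun j x hx =>
        memLp_two_mul_of_indepFun (hUind j _ _ a b (Finset.mem_offDiag.1 hx).2.2) (hUa _ _ _)
          (hUa _ _ _)
      refine ⟨UniformL2.average (B := max M 0 * max M 0)
        (s := fun j => (Finset.univ : Finset (Fin (r j))).offDiag)
        (f := fun j x ω => U j x.1 ω a * U j x.2 ω b) (by positivity)
        (fun j x hx => (hmul j x hx).1) fun j x hx => ?_, fun j => ?_⟩
      · rw [(hmul j x hx).2]
        exact mul_le_mul (hUsq _ _ _) (hUsq _ _ _) (integral_nonneg fun ω => sq_nonneg _)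
          (le_max_right _ _)
      · simp only [paddedOffDiagMean, Matrix.fromBlocks_apply₁₁, Matrix.of_apply, offDiagMean]
        rw [integral_const_mul, integral_finsetSum _ fun x hx =>
          (hmul j x hx).1.integrable (by norm_num), Finset.sum_eq_zero fun x hx => ?_, mul_zero]
        rw [(hUind j _ _ a b (Finset.mem_offDiag.1 hx).2.2).integral_fun_mul_eq_mul_integral
          (hUa _ _ _).aestronglyMeasurable (hUa _ _ _).aestronglyMeasurable, hU0, zero_mul]
    all_goals simpa [paddedOffDiagMean] using hzero
  · refine ⟨⟨hε2, ∫ ω, ε 0 ω ^ 2 ∂μ, fun j => le_of_eq ?_⟩, hε0⟩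
    have hm : Measurable fun x : (Idx p q → ℝ) × ℝ => x.2 ^ 2 := by fun_prop
    exact ((hident j).comp hm).integral_eq

end Reduction

end EIV

theorem theorem1 {Ω : Type*} [MeasurableSpace Ω] (μ : Measure Ω) [IsProbabilityMeasure μ]
    (p q : ℕ)
    -- the variables of the model: replicate numbers, covariates, errors, error covariances
    (r : ℕ → ℕ) (hr : ∀ j, 2 ≤ r j)
    (X : ℕ → Ω → Fin p → ℝ) (Z : ℕ → Ω → Fin q → ℝ) (ε : ℕ → Ω → ℝ)
    (U : (j : ℕ) → Fin (r j) → Ω → Fin p → ℝ)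
    (SigmaU : ℕ → Matrix (Fin p) (Fin p) ℝ)
    (hXm : ∀ j, Measurable (X j)) (hZm : ∀ j, Measurable (Z j)) (hεm : ∀ j, Measurable (ε j))
    (hUm : ∀ j k, Measurable (U j k))
    -- two finite moments; for the measurement errors uniformly over the observations
    (hX2 : ∀ j, MemLp (X j) 2 μ) (hZ2 : ∀ j, MemLp (Z j) 2 μ) (hε2 : ∀ j, MemLp (ε j) 2 μ)
    (hU2 : ∀ j k, MemLp (U j k) 2 μ)
    (hε0 : ∀ j, ∫ ω, ε j ω ∂μ = 0)
    (hU0 : ∀ j k a, ∫ ω, U j k ω a ∂μ = 0)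
    (hUcov : ∀ j k a b, cov[fun ω => U j k ω a, fun ω => U j k ω b; μ] = SigmaU j a b)
    (hSigma : ∃ M : ℝ, ∀ j a, SigmaU j a a ≤ M)
    -- independent observations
    (hind : iIndepFun (fun (j : ℕ) (ω : Ω) => (X j ω, Z j ω, ε j ω, fun k => U j k ω)) μ)
    -- within an observation, the replicate errors, the covariates and the regression error
    -- are independent
    (hUU : ∀ j, iIndepFun (fun (k : Fin (r j)) (ω : Ω) => U j k ω) μ)
    (hUXZ : ∀ j, IndepFun (fun ω => fun k => U j k ω) (fun ω => (X j ω, Z j ω, ε j ω)) μ)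
    (hXZε : ∀ j, IndepFun (fun ω => (X j ω, Z j ω)) (ε j) μ)
    (hid : ∀ j, IdentDistrib (fun ω => (X j ω, Z j ω, ε j ω))
      (fun ω => (X 0 ω, Z 0 ω, ε 0 ω)) μ μ)
    -- symmetric errors with strictly positive characteristic functions
    (hUsym : ∀ j k, EIV.SymmetricPositive μ (U j k))
    (hεsym : ∀ j, EIV.SymmetricPositive μ (fun ω (_ : Fin 1) => ε j ω))
    -- the covariates are not collinear
    (hM : (EIV.covariateMoment μ (X 0) (Z 0)).PosDef)
    -- the parameter space
    (Θ : Set (EIV.Param p q)) (hΘc : IsCompact Θ) (hΘconv : Convex ℝ Θ)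
    (θ₀ : EIV.Param p q) (hθ₀ : θ₀ ∈ interior Θ)
    -- the weights for each sample size
    (w : ℕ → ℕ → ℝ) (hw0 : ∀ n, ∀ j < n, 0 ≤ w n j)
    (hw1 : ∀ n, 1 ≤ n → ∑ j ∈ Finset.range n, w n j = 1)
    (hwmax : ∃ C : ℝ, ∀ n, ∀ j < n, w n j ≤ C / n)
    -- the kernel of the phase function discrepancy
    (tstar : ℝ) (ht : 0 < tstar) (K : ℝ → ℝ) (hK0 : ∀ t, 0 ≤ K t)
    (hKsupp : ∀ t, t ∉ Set.Icc 0 tstar → K t = 0)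
    (hKint : IntervalIntegrable K volume 0 tstar)
    -- the stacked score for each sample size, its covariance matrix at `θ₀`, and `Q`
    (S : ℕ → Ω → EIV.Param p q → EIV.Idx p q ⊕ EIV.Idx p q → ℝ)
    (hS : S = fun n ω θ => (EIV.modelData θ₀ r X Z ε U ω).score (w n) K tstar n θ)
    (OmegaS : ℕ → Matrix (EIV.Idx p q ⊕ EIV.Idx p q) (EIV.Idx p q ⊕ EIV.Idx p q) ℝ)
    (hOmegaS : OmegaS = fun n => EIV.covMatrix μ (fun ω => S n ω θ₀))
    (Q : ℕ → Ω → EIV.Param p q → ℝ)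
    (hQ : Q = fun n ω θ => EIV.quadForm (OmegaS n) (S n ω θ))
    -- `Ω_S` is nonsingular for large `n`, with inverse of operator norm `o(n ^ 3)`
    (hnondeg : ∀ C : ℝ, ∀ᶠ n : ℕ in atTop, ((n : ℝ) ^ 3 • OmegaS n - C • 1).PosSemidef) :
    -- `S` has finite variance at `θ₀`, so that `Ω_S` is well defined
    (∀ n i, MemLp (fun ω => S n ω θ₀ i) 2 μ) ∧
    -- `Q` has a minimizer
    (∀ n ω, ∃ θ ∈ Θ, IsMinOn (Q n ω) Θ θ) ∧
    -- every choice of minimizers is consistent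
    (∀ θhat : ℕ → Ω → EIV.Param p q,
      (∀ n, ∀ᵐ ω ∂μ, θhat n ω ∈ Θ ∧ IsMinOn (Q n ω) Θ (θhat n ω)) →
      TendstoInMeasure μ θhat atTop (fun _ => θ₀)) := by

  have hsymε : ∀ j, IdentDistrib (ε j) (fun ω => -ε j ω) μ μ := fun j =>
    (hεsym j).1.comp (u := fun x : Fin 1 → ℝ => x 0) (measurable_pi_apply 0)
  have hred := EIV.reducedModel hXm hZm hεm hUm hX2 hZ2 hε2 hU2 hε0 hU0 hUcov hSigma hind hUU
    hUXZ hXZε hid (fun j k => (hUsym j k).1) hsymε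
  have hσm := (EIV.continuous_kernelSin hKint).measurable
  have hσb := EIV.abs_kernelSin_le ht hKint
  have hSeq : ∀ n ω θ, S n ω θ = Sum.elim
      (EIV.linScore (fun j => EIV.corrGram (Sum.elim (X j ω) (EIV.withIntercept (Z j ω)))
          (EIV.paddedMean q fun k => U j k ω) (EIV.paddedOffDiagMean q fun k => U j k ω))
        (fun j a => (Sum.elim (X j ω) (EIV.withIntercept (Z j ω)) : EIV.Param p q) a
          + EIV.paddedMean q (fun k => U j k ω) a)
        (fun j => Sum.elim (X j ω) (EIV.withIntercept (Z j ω)) ⬝ᵥ θ₀ + ε j ω) n θ)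
      (EIV.phaseGrad (EIV.kernelSin K tstar) (w n)
        (fun j a => (Sum.elim (X j ω) (EIV.withIntercept (Z j ω)) : EIV.Param p q) a
          + EIV.paddedMean q (fun k => U j k ω) a)
        (fun j => Sum.elim (X j ω) (EIV.withIntercept (Z j ω)) ⬝ᵥ θ₀ + ε j ω) n θ) := by
    intro n ω θ
    have hA : (EIV.modelData θ₀ r X Z ε U ω).covariates = fun j a =>
        (Sum.elim (X j ω) (EIV.withIntercept (Z j ω)) : EIV.Param p q) a
          + EIV.paddedMean q (fun k => U j k ω) a :=
      funext fun j => funext fun a => EIV.modelData_covariates θ₀ X Z ε U ω hr j a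
    have hH : (EIV.modelData θ₀ r X Z ε U ω).corrSquares = fun j =>
        EIV.corrGram (Sum.elim (X j ω) (EIV.withIntercept (Z j ω)))
          (EIV.paddedMean q fun k => U j k ω) (EIV.paddedOffDiagMean q fun k => U j k ω) :=
      funext fun j => EIV.modelData_corrSquares θ₀ X Z ε U ω hr j
    have hy : (EIV.modelData θ₀ r X Z ε U ω).y = fun j =>
        Sum.elim (X j ω) (EIV.withIntercept (Z j ω)) ⬝ᵥ θ₀ + ε j ω :=
      funext fun j => EIV.modelData_y θ₀ r X Z ε U ω j
    rw [hS, ← hA, ← hH, ← hy]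
    simp only [EIV.Data.score, EIV.Data.scoreL_eq, EIV.Data.scoreD_eq _ hKint]
  refine ⟨fun n i => ?_, fun n ω => ?_, fun θhat hmin => ?_⟩
  · simp only [hSeq]
    rcases i with a | a
    · exact hred.memLp_linScore θ₀ n a
    · exact hred.memLp_phaseGrad hσm hσb (w n) n θ₀ a
  · refine hΘc.exists_isMinOn ⟨θ₀, interior_subset hθ₀⟩ (Continuous.continuousOn ?_)
    rw [hQ, hS]
    exact (EIV.continuous_quadForm _).comp (EIV.Data.continuous_score _ hKint (w n) n)
  · subst hOmegaS hQ
    exact hred.tendstoInMeasure_minimizer hM hσm hσb EIV.kernelSin_neg hw0 hw1 hwmax hΘc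
      (interior_subset hθ₀) hSeq hnondeg hmin
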